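/- Let $G=(A\cup B,E)$ be a finite bipartite graph (agents $A$, jobs $B$) in which every vertex strictly ranks its neighbours and every agent has at least one neighbour. For matchings $M,N$ of $G$ let $\phi(M,N)$ be the number of vertices, and $\phi_A(M,N)$ the number of agents, that prefer $M$ to $N$ (being unmatched is worst). $M$ is popular if $\phi(M,N)\ge\phi(N,M)$ for all matchings $N$, $A$-popular if $\phi_A(M,N)\ge\phi_A(N,M)$ for all $N$, and fully popular if it is both. Legal edges. Let $f(a)$ be the top choice of $a\in A$ and $s(a)$ its best neighbour that is nobody's top choice ($s(a)=a$ if there is none). Valid are the edges and self-loops $(a,f(a))$, $(a,s(a))$ for $a\in A$, and the self-loops $(b,b)$ for jobs $b$ that are no agent's top choice. An edge is popular if some popular matching contains it; a self-loop $(u,u)$ is popular if some popular matching leaves $u$ unmatched. Legal means valid and popular. Let $G_0$ be the graph of popular edges on $A\cup B$. The graph $H$ has vertices $u_\ell$ (left) and $u_r$ (right) for $u\in A\cup B$. For every two adjacent $u,v$ in $G$ it has two parallel edges $(u_\ell^+,v_r^-)$ and $(u_\ell^-,v_r^+)$, and for every $u$ it has one edge $(u_\ell^-,u_r^+)$. A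 vertex of $H$ prefers neighbours with superscript $-$ to those with superscript $+$; among equal superscripts it uses its order in $G$, its own twin being last. A matching of $H$ is stable if no edge of $H$ is preferred by both of its ends to their assignments. Each edge of $H$ coming from an edge or self-loop that is not legal is forbidden. The algorithm. Run the Gale–Shapley algorithm with forbidden edges in $H$: the left vertices propose along their best remaining edges; when a right vertex gets a proposal along $e$, all its edges worse than $e$ are deleted, and so is $e$ if it is forbidden. If some vertex ends up unmatched, stop without a matching; otherwise let $S_0$ be the result and let all vertices be unmarked. Given $S_{i}$, let $A_-$ and $B_+$ be the sets of agents $a$ and jobs $b$ on edges $(a_\ell^-,b_r^+)\in S_{i}$, and $A'_+$ and $B'_-$ the sets of agents $a$ and jobs $b$ on edges $(b_\ell^-,a_r^+)\in S_{i}$, with $a\in A$, $b\in B$. While there is an unmarked $v\in(A_-\cap A'_+)\cup(B_+\cap B'_-)$, choose any such $v$, additionally forbid all edges $(a_\ell^+,\ast)$ and $(\ast,a_r^-)$ for all agents $a$ in the component of $v$ in $G_0$, continue the Gale–Shapley algorithm from its current state with these forbidden edges (stopping without a matching if a vertex ends up unmatched) to get $S_{i+1}$, and mark all vertices of the component of $v$.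 When there is no such $v$, return $M=\{(a,b)\in E:(a_\ell^+,b_r^-)\in S_i\text{ or }(a_\ell^-,b_r^+)\in S_i\}$ for the last $S_i$. Lemma. Suppose that an execution of the algorithm (with any choices of $v$ and any order of proposals) returns a matching $M$. Let $S_i$ be its last matching of $H$, $\mathcal D_i$ the set of stable matchings of $H$ that contain no edge forbidden during the execution, and $U_A=\{a\in A:(a_\ell^-,a_r^+)\in S_i\}$. Then 1. $M$ is a fully popular matching of $G$, and $|N|\le|M|$ for every fully popular matching $N$ of $G$; 2. $S_i$ is the left-optimal element of $\mathcal D_i$: $S_i\in\mathcal D_i$, and every left vertex of $H$ is matched in $S_i$ at least as well as in any member of $\mathcal D_i$; 3. $U_A$ is exactly the set of agents left unmatched by $M$, and every agent in $U_A$ is unmatched in every fully popular matching of $G$. -/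

import Mathlib

/-- A marriage instance with agents `A` and jobs `B`: a bipartite graph in which every vertex has a
strict ranking of its neighbours. A smaller rank is a better one; ranks of non-neighbours are
irrelevant. -/
structure Marriage (A B : Type*) where
  Adj : A → B → Prop
  rankA : A → B → ℕ
  rankB : B → A → ℕ
  rankA_inj : ∀ a b b', Adj a b → Adj a b' → rankA a b = rankA a b' → b = b'
  rankB_inj : ∀ b a a', Adj a b → Adj a' b → rankB b a = rankB b a' → a = a'

namespace Marriage

variable {A B : Type*} (G : Marriage A B)

/-! ### Matchings, popularity -/

/-- `M` is a matching of the graph, given as a set of edges. -/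
def IsMatching (M : Set (A × B)) : Prop :=
  (∀ a b, (a, b) ∈ M → G.Adj a b) ∧
  (∀ a b b', (a, b) ∈ M → (a, b') ∈ M → b = b') ∧
  (∀ a a' b, (a, b) ∈ M → (a', b) ∈ M → a = a')

/-- Agent `a` votes for `M` against `N`: it is matched in `M`, and in `N` it is unmatched or has a
worse partner. -/
def AgentPrefers (M N : Set (A × B)) (a : A) : Prop :=
  ∃ b, (a, b) ∈ M ∧ ∀ b', (a, b') ∈ N → G.rankA a b < G.rankA a b'

/-- Job `b` votes for `M` against `N`. -/
def JobPrefers (M N : Set (A × B)) (b : B) : Prop :=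
  ∃ a, (a, b) ∈ M ∧ ∀ a', (a', b) ∈ N → G.rankB b a < G.rankB b a'

/-- The number of agents that vote for `M` against `N`. -/
noncomputable def phiA (M N : Set (A × B)) : ℕ := {a | G.AgentPrefers M N a}.ncard

/-- The number of vertices (agents and jobs) that vote for `M` against `N`. -/
noncomputable def phi (M N : Set (A × B)) : ℕ := G.phiA M N + {b | G.JobPrefers M N b}.ncard

def Popular (M : Set (A × B)) : Prop :=
  G.IsMatching M ∧ ∀ N, G.IsMatching N → G.phi N M ≤ G.phi M N

def APopular (M : Set (A × B)) : Prop :=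
  G.IsMatching M ∧ ∀ N, G.IsMatching N → G.phiA N M ≤ G.phiA M N

def FullyPopular (M : Set (A × B)) : Prop := G.Popular M ∧ G.APopular M

/-- `M` is a fully popular matching of maximum size among the fully popular matchings. -/
def MaxSizeFullyPopular (M : Set (A × B)) : Prop :=
  G.FullyPopular M ∧ ∀ N, G.FullyPopular N → N.ncard ≤ M.ncard

/-! ### Valid, popular and legal edges of the graph augmented with self-loops

The vertex set is `A ⊕ B`. The pair `(u, u)` stands for the self-loop at `u`; a matching contains
the self-loop at `u` if it leaves `u` unmatched. -/

/-- `b = f(a)`: the job `b` is the top choice of `a`. -/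
def IsF (a : A) (b : B) : Prop :=
  G.Adj a b ∧ ∀ b', G.Adj a b' → G.rankA a b ≤ G.rankA a b'

/-- `b` is the top choice of some agent. -/
def IsTopJob (b : B) : Prop := ∃ a, G.IsF a b

/-- `b = s(a)`: the job `b` is the best neighbour of `a` that is nobody's top choice. -/
def IsS (a : A) (b : B) : Prop :=
  G.Adj a b ∧ ¬ G.IsTopJob b ∧ ∀ b', G.Adj a b' → ¬ G.IsTopJob b' → G.rankA a b ≤ G.rankA a b'

/-- `s(a) = a`: all neighbours of `a` are top choices of agents. -/
def SIsSelf (a : A) : Prop := ∀ b, G.Adj a b → G.IsTopJob b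

/-- Valid edges and self-loops. -/
def Valid : A ⊕ B → A ⊕ B → Prop
  | .inl a, .inr b => G.IsF a b ∨ G.IsS a b
  | .inr b, .inl a => G.IsF a b ∨ G.IsS a b
  | .inl a, .inl a' => a = a' ∧ G.SIsSelf a
  | .inr b, .inr b' => b = b' ∧ ¬ G.IsTopJob b

/-- Popular edges and self-loops: those contained in some popular matching. -/
def PopularEdge : A ⊕ B → A ⊕ B → Prop
  | .inl a, .inr b => ∃ M, G.Popular M ∧ (a, b) ∈ M
  | .inr b, .inl a => ∃ M, G.Popular M ∧ (a, b) ∈ M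
  | .inl a, .inl a' => a = a' ∧ ∃ M, G.Popular M ∧ ∀ b, (a, b) ∉ M
  | .inr b, .inr b' => b = b' ∧ ∃ M, G.Popular M ∧ ∀ a, (a, b) ∉ M

def Legal (u v : A ⊕ B) : Prop := G.Valid u v ∧ G.PopularEdge u v

/-- The popular subgraph (self-loops do not matter for its components). -/
def popularGraph : SimpleGraph (A ⊕ B) := SimpleGraph.fromRel G.PopularEdge

/-- The vertex set of the component of `v` in the popular subgraph. -/
def component (v : A ⊕ B) : Set (A ⊕ B) := {u | G.popularGraph.Reachable v u}

/-! ### The bipartite graph `H` -/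

/-- Adjacency of the original graph on `A ⊕ B`. -/
def VAdj : A ⊕ B → A ⊕ B → Prop
  | .inl a, .inr b => G.Adj a b
  | .inr b, .inl a => G.Adj a b
  | _, _ => False

/-- The rank that `u` gives to `v`; `u` itself is at the bottom of its own list. -/
def rank : A ⊕ B → A ⊕ B → ℕ∞
  | .inl a, .inr b => (G.rankA a b : ℕ∞)
  | .inr b, .inl a => (G.rankB b a : ℕ∞)
  | _, _ => ⊤

/-- A potential edge of `H` between the left copy of `left` and the right copy of `right`.
If `plus = true`, it is `(left⁺, right⁻)`; if `plus = false`, it is `(left⁻, right⁺)`. -/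
@[ext] structure HEdge (A B : Type*) where
  left : A ⊕ B
  right : A ⊕ B
  plus : Bool

/-- The edges of `H`: for adjacent `u`, `v` the two parallel edges `(u⁺, v⁻)` and `(u⁻, v⁺)` from
the left copy of `u` to the right copy of `v`, and for every vertex `u` the edge `(u⁻, u⁺)`. -/
def HEdges : Set (HEdge A B) :=
  {e | G.VAdj e.left e.right ∨ (e.left = e.right ∧ e.plus = false)}

/-- The position of `e` in the preference list of its left end (smaller is better): neighbours
with superscript `-` come before those with superscript `+`, then the original order counts. -/
def leftKey (e : HEdge A B) : Bool ×ₗ ℕ∞ := toLex (!e.plus, G.rank e.left e.right)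

/-- The position of `e` in the preference list of its right end (smaller is better). -/
def rightKey (e : HEdge A B) : Bool ×ₗ ℕ∞ := toLex (e.plus, G.rank e.right e.left)

def IsHMatching (S : Set (HEdge A B)) : Prop :=
  S ⊆ G.HEdges ∧
  (∀ e ∈ S, ∀ e' ∈ S, e.left = e'.left → e = e') ∧
  (∀ e ∈ S, ∀ e' ∈ S, e.right = e'.right → e = e')

/-- `e` blocks `S`: both ends prefer `e` to their assignment in `S` (an unmatched vertex prefers
every edge to its assignment). -/
def Blocks (e : HEdge A B) (S : Set (HEdge A B)) : Prop :=
  e ∈ G.HEdges ∧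
  (∀ e' ∈ S, e'.left = e.left → G.leftKey e < G.leftKey e') ∧
  (∀ e' ∈ S, e'.right = e.right → G.rightKey e < G.rightKey e')

def HStable (S : Set (HEdge A B)) : Prop := G.IsHMatching S ∧ ∀ e, ¬ G.Blocks e S

/-- The edges of `H` that come from edges or self-loops that are not legal. -/
def illegalEdges : Set (HEdge A B) := {e | e ∈ G.HEdges ∧ ¬ G.Legal e.left e.right}

/-- The stable matchings of `H` that avoid `F`. -/
def stableAvoiding (F : Set (HEdge A B)) : Set (Set (HEdge A B)) :=
  {S | G.HStable S ∧ Disjoint S F}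

/-- `S` is the left-optimal element of the family `D` of matchings of `H`: every vertex on the left
of `H` is matched in `S` at least as well as in any member of `D`. -/
def IsLeftOptimal (D : Set (Set (HEdge A B))) (S : Set (HEdge A B)) : Prop :=
  S ∈ D ∧ ∀ T ∈ D, ∀ e ∈ T, ∃ e' ∈ S, e'.left = e.left ∧ G.leftKey e' ≤ G.leftKey e

/-! ### The Gale-Shapley algorithm with forbidden edges in `H`

The state is the set `R` of edges of `H` deleted so far. -/

/-- `e` is the best remaining edge of its left end, that is, the one it proposes along. -/
def IsBest (R : Set (HEdge A B)) (e : HEdge A B) : Prop :=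
  e ∈ G.HEdges ∧ e ∉ R ∧
  ∀ e' ∈ G.HEdges, e' ∉ R → e'.left = e.left → G.leftKey e ≤ G.leftKey e'

/-- One effective proposal: a left vertex proposes along its best remaining edge `e`. All edges that
the receiver ranks below `e` are deleted, and so is `e` itself if it is forbidden. Proposals that
delete nothing new are not counted as steps. -/
def GSStep (F R R' : Set (HEdge A B)) : Prop :=
  ∃ e, G.IsBest R e ∧
    R' = R ∪ {e' | e' ∈ G.HEdges ∧ e'.right = e.right ∧
      (G.rightKey e < G.rightKey e' ∨ (e' = e ∧ e ∈ F))} ∧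
    R' ≠ R

/-- A complete run of the algorithm with forbidden edges `F` from `R` to the final state `R'`. -/
def GSRun (F R R' : Set (HEdge A B)) : Prop :=
  Relation.ReflTransGen (G.GSStep F) R R' ∧ ∀ R'', ¬ G.GSStep F R' R''

/-- Every left vertex still has an edge, so the run leaves no vertex unmatched. -/
def Succeeds (R : Set (HEdge A B)) : Prop := ∀ u, ∃ e, G.IsBest R e ∧ e.left = u

/-- The matching of `H` held in a final state. -/
def held (R : Set (HEdge A B)) : Set (HEdge A B) := {e | G.IsBest R e}

/-! ### The algorithm for fully popular matchings -/

/-- The sets `A₋` and `B₊` of the upper half, and `A'₊` and `B'₋` of the lower half. -/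
def AMinus (S : Set (HEdge A B)) : Set A := {a | ∃ b : B, ⟨.inl a, .inr b, false⟩ ∈ S}

def BPlus (S : Set (HEdge A B)) : Set B := {b | ∃ a : A, ⟨.inl a, .inr b, false⟩ ∈ S}

def APlus' (S : Set (HEdge A B)) : Set A := {a | ∃ b : B, ⟨.inr b, .inl a, false⟩ ∈ S}

def BMinus' (S : Set (HEdge A B)) : Set B := {b | ∃ a : A, ⟨.inr b, .inl a, false⟩ ∈ S}

/-- The set `(A₋ ∩ A'₊) ∪ (B₊ ∩ B'₋)`. -/
def critical (S : Set (HEdge A B)) : Set (A ⊕ B) :=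
  Sum.inl '' (AMinus S ∩ APlus' S) ∪ Sum.inr '' (BPlus S ∩ BMinus' S)

/-- The edges `(a⁺, *)` at the left copy and `(*, a⁻)` at the right copy of an agent `a` in the
component of `v`. -/
def forbiddenAt (v : A ⊕ B) : Set (HEdge A B) :=
  {e | e ∈ G.HEdges ∧ e.plus = true ∧
    ∃ a : A, Sum.inl a ∈ G.component v ∧ (e.left = .inl a ∨ e.right = .inl a)}

/-- `G.Reaches F R Z`: some execution of the algorithm reaches the test of the while-loop with
forbidden edges `F`, deleted edges `R` (so the current matching of `H` is `G.held R`) and set of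
marked vertices `Z`. Each iteration picks any unmarked vertex of the critical set, forbids further
edges and continues the Gale-Shapley algorithm from the current state. An execution in which a
Gale-Shapley run leaves a vertex unmatched stops without a matching. -/
inductive Reaches : Set (HEdge A B) → Set (HEdge A B) → Set (A ⊕ B) → Prop
  | init (R : Set (HEdge A B)) (hrun : G.GSRun G.illegalEdges ∅ R) (hs : G.Succeeds R) :
      Reaches G.illegalEdges R ∅
  | iter (F R R' : Set (HEdge A B)) (Z : Set (A ⊕ B)) (v : A ⊕ B) (hprev : Reaches F R Z)
      (hv : v ∈ critical (G.held R)) (hvZ : v ∉ Z)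
      (hrun : G.GSRun (F ∪ G.forbiddenAt v) R R') (hs : G.Succeeds R') :
      Reaches (F ∪ G.forbiddenAt v) R' (Z ∪ G.component v)

/-- The matching of the original graph induced by the upper half of `S`. -/
def upper (S : Set (HEdge A B)) : Set (A × B) :=
  {p | ∃ s : Bool, ⟨.inl p.1, .inr p.2, s⟩ ∈ S}

/-- The set `U_A` of agents whose two copies are matched to each other. -/
def UA (S : Set (HEdge A B)) : Set A := {a | ⟨.inl a, .inl a, false⟩ ∈ S}

/-- Some execution of the algorithm ends successfully with final matching `S` of `H`, final set `F`
of forbidden edges and returned matching `M`. -/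
def Returns (F S : Set (HEdge A B)) (M : Set (A × B)) : Prop :=
  ∃ R Z, G.Reaches F R Z ∧ critical (G.held R) ⊆ Z ∧ S = G.held R ∧ M = upper S

end Marriage

/-! Popularity is linear programming duality. A matching is popular iff some potential `α` covers
the vote sums of all edges and loops and has total at most 0 (`IsWitness`,
`Popular.exists_witness`); integrality and the loops force values in {-1, 0, 1}. By complementary
slackness `α` cancels along the matching, and its parity is constant on components of the popular
subgraph. `A`-popularity is local: it says that all edges and loops are valid (`APopular.valid`,
`aPopular_of_valid`).

No fully popular matching `N` is lost. A witness `α` of `N` turns `N` into a stable matching `lift`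
of `H`, which uses legal edges only. Since the current matching is left-optimal and right-pessimal
in its family, a critical vertex `v` has `α v = 0` in every such witness; by parity `α` vanishes on
the component of `v`, so the newly forbidden edges are not in the lift
(`FullyPopular.lift_mem_stableAvoiding`).

The output is fully popular. The final stable matching splits into an upper half `p` with signs `σ`
and a lower half `q` with signs `τ`, leaving the same vertices unmatched. Both consist of valid
edges, so `p` is `A`-popular. The signs almost form a witness of `p`, but do not cancel at unmatched
vertices. Marked agents and unmatched agents have signs `σ = -1`, `τ = 1`, and no other agent has.
Comparing the halves by complementary slackness shows that they agree at marked vertices, and that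
replacing `σ` by 0 at marked and unmatched vertices gives a witness (`IsHalves.isWitness`).

Size: an agent whose left copy holds its own twin in the left-optimal matching has nothing better in
any lift, so every fully popular matching leaves it unmatched. -/

/-- Egerváry's theorem for permutations along a relation, with integral dual solutions. -/
theorem exists_dual_of_perm_weight_nonpos {V : Type*} [Fintype V] (R : V → V → Prop)
    (w : V → V → ℤ)
    (h : ∀ σ : Equiv.Perm V, (∀ u, R u (σ u)) → ∑ u, w u (σ u) ≤ 0) :
    ∃ x y : V → ℤ, (∀ u v, R u v → w u v ≤ x u + y v) ∧ ∑ u, x u + ∑ u, y u ≤ 0 := by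
  classical
  have key : ∀ n : ℕ, ∀ x y : V → ℤ, (∀ u v, R u v → w u v ≤ x u + y v) →
      ∑ u, x u + ∑ u, y u ≤ n →
      ∃ x y : V → ℤ, (∀ u v, R u v → w u v ≤ x u + y v) ∧ ∑ u, x u + ∑ u, y u ≤ 0 := by
    intro n
    induction n with
    | zero => intro x y hf hs; exact ⟨x, y, hf, by simpa using hs⟩
    | succ n ih =>
      intro x y hf hs
      -- `t u` lists the tight edges at `u`. A permutation of tight edges has weight equal to the
      -- dual objective, hence at most 0.
      let t : V → Finset V := fun u => Finset.univ.filter fun v => R u v ∧ x u + y v = w u v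
      by_cases hall : ∀ s : Finset V, s.card ≤ (s.biUnion t).card
      · obtain ⟨f, hinj, hft⟩ := (Finset.all_card_le_biUnion_card_iff_exists_injective t).1 hall
        let σ : Equiv.Perm V := Equiv.ofBijective f (Finite.injective_iff_bijective.1 hinj)
        have hσ : ∀ u, R u (σ u) ∧ x u + y (σ u) = w u (σ u) := fun u =>
          (Finset.mem_filter.1 (hft u)).2
        refine ⟨x, y, hf, ?_⟩
        have h1 := h σ fun u => (hσ u).1
        rw [← Equiv.sum_comp σ y, ← Finset.sum_add_distrib, Finset.sum_congr rfl fun u _ => (hσ u).2]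
        exact h1
      · push Not at hall
        obtain ⟨s, hlt⟩ := hall
        -- Shifting by 1 along a Hall violator `s` lowers the objective. The edges leaving `s`
        -- outside `t` have integral slack at least 1, so feasibility survives.
        refine ih (fun u => x u - if u ∈ s then 1 else 0)
          (fun v => y v + if v ∈ s.biUnion t then 1 else 0) ?_ ?_
        · intro u v huv
          have h1 := hf u v huv
          by_cases hu : u ∈ s
          · by_cases hv : v ∈ s.biUnion t
            · simp only [hu, hv, if_true]; omega
            · have : x u + y v ≠ w u v := fun h2 =>
                hv (Finset.mem_biUnion.2 ⟨u, hu, by simp [t, huv, h2]⟩)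
              simp only [hu, hv, if_true, if_false]; omega
          · simp only [hu, if_false]; split_ifs <;> omega
        · simp only [Finset.sum_sub_distrib, Finset.sum_add_distrib, Finset.sum_ite_mem,
            Finset.univ_inter, Finset.sum_const, nsmul_eq_mul, mul_one]
          push_cast at hs
          omega
  have hnn : ∀ u v, w u v ≤ ∑ v', |w u v'| := fun u v =>
    (le_abs_self _).trans (Finset.single_le_sum (f := fun v' => |w u v'|)
      (fun _ _ => abs_nonneg _) (Finset.mem_univ v))
  refine key (∑ u, ∑ v', |w u v'|).toNat (fun u => ∑ v', |w u v'|) (fun _ => 0)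
    (fun u v _ => by simpa using hnn u v) ?_
  simp

namespace Marriage

variable {A B : Type*} (G : Marriage A B)

/-! ### Ranks and keys -/

theorem VAdj.symm {G : Marriage A B} {u v : A ⊕ B} (h : G.VAdj u v) : G.VAdj v u := by
  rcases u with a | b <;> rcases v with a' | b' <;> exact h

theorem VAdj.ne {G : Marriage A B} {u v : A ⊕ B} (h : G.VAdj u v) : u ≠ v := by
  rcases u with a | b <;> rcases v with a' | b' <;> simp_all [VAdj]

theorem rank_self (u : A ⊕ B) : G.rank u u = ⊤ := by
  rcases u with a | b <;> rfl

theorem rank_lt_top {G : Marriage A B} {u v : A ⊕ B} (h : G.VAdj u v) : G.rank u v < ⊤ := by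
  rcases u with a | b <;> rcases v with a' | b' <;> simp_all [VAdj, rank]

/-- `v` is `u` itself or a neighbour of `u`. -/
def Opt (u v : A ⊕ B) : Prop := v = u ∨ G.VAdj u v

theorem Opt.symm {G : Marriage A B} {u v : A ⊕ B} (h : G.Opt u v) : G.Opt v u :=
  h.imp Eq.symm VAdj.symm

theorem Opt.vadj {G : Marriage A B} {u v : A ⊕ B} (h : G.Opt u v) (hne : v ≠ u) : G.VAdj u v :=
  h.resolve_left hne

theorem rank_inj {G : Marriage A B} {u v w : A ⊕ B} (hv : G.Opt u v) (hw : G.Opt u w)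
    (h : G.rank u v = G.rank u w) : v = w := by
  rcases hv with rfl | hv
  · rcases hw with rfl | hw
    · rfl
    · rw [rank_self] at h; exact absurd h.symm (rank_lt_top hw).ne
  · rcases hw with rfl | hw
    · rw [rank_self] at h; exact absurd h (rank_lt_top hv).ne
    · rcases u with a | b <;> rcases v with a' | b' <;> rcases w with a'' | b'' <;>
        simp_all only [VAdj, rank, Nat.cast_inj]
      · rw [G.rankA_inj _ _ _ hv hw h]
      · rw [G.rankB_inj _ _ _ hv hw h]

theorem opt_of_mem_hedges {G : Marriage A B} {e : HEdge A B} (h : e ∈ G.HEdges) :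
    G.Opt e.left e.right := by
  rcases h with h | h
  · exact Or.inr h
  · exact Or.inl h.1.symm

theorem leftKey_inj {G : Marriage A B} {e e' : HEdge A B} (h : e ∈ G.HEdges) (h' : e' ∈ G.HEdges)
    (hl : e.left = e'.left) (hk : G.leftKey e = G.leftKey e') : e = e' := by
  have h1 := opt_of_mem_hedges h
  have h2 := opt_of_mem_hedges h'
  simp only [leftKey, EmbeddingLike.apply_eq_iff_eq, Prod.mk.injEq, Bool.not_inj_iff] at hk
  rw [← hl] at h2
  have := rank_inj h1 h2 (by rw [hk.2, hl])
  exact HEdge.ext hl this hk.1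

theorem rightKey_inj {G : Marriage A B} {e e' : HEdge A B} (h : e ∈ G.HEdges) (h' : e' ∈ G.HEdges)
    (hr : e.right = e'.right) (hk : G.rightKey e = G.rightKey e') : e = e' := by
  have h1 := (opt_of_mem_hedges h).symm
  have h2 := (opt_of_mem_hedges h').symm
  simp only [rightKey, EmbeddingLike.apply_eq_iff_eq, Prod.mk.injEq] at hk
  rw [← hr] at h2
  have := rank_inj h1 h2 (by rw [hk.2, hr])
  exact HEdge.ext this hr hk.1

theorem leftKey_lt_iff {e e' : HEdge A B} : G.leftKey e < G.leftKey e' ↔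
    (e.plus = true ∧ e'.plus = false) ∨
      (e.plus = e'.plus ∧ G.rank e.left e.right < G.rank e'.left e'.right) := by
  simp only [leftKey, Prod.Lex.toLex_lt_toLex]
  cases e.plus <;> cases e'.plus <;> simp

theorem rightKey_lt_iff {e e' : HEdge A B} : G.rightKey e < G.rightKey e' ↔
    (e.plus = false ∧ e'.plus = true) ∨
      (e.plus = e'.plus ∧ G.rank e.right e.left < G.rank e'.right e'.left) := by
  simp only [rightKey, Prod.Lex.toLex_lt_toLex]
  cases e.plus <;> cases e'.plus <;> simp

/-! ### The Gale-Shapley algorithm with forbidden edges -/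

variable {G}

/-- The state of the algorithm is closed under passing to worse edges at a right vertex, and no
deleted edge belongs to a stable matching avoiding the forbidden edges. -/
structure GSInv (G : Marriage A B) (F R : Set (HEdge A B)) : Prop where
  closed : ∀ e ∈ R, ∀ e' ∈ G.HEdges, e'.right = e.right → G.rightKey e < G.rightKey e' → e' ∈ R
  disjoint : ∀ T ∈ G.stableAvoiding F, ∀ e ∈ T, e ∉ R

theorem GSInv.empty (F : Set (HEdge A B)) : GSInv G F ∅ :=
  ⟨fun _ h => h.elim, fun _ _ _ _ h => h⟩

theorem GSInv.mono {F F' R : Set (HEdge A B)} (h : GSInv G F R) (hF : F ⊆ F') : GSInv G F' R :=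
  ⟨h.closed, fun T hT => h.disjoint T ⟨hT.1, hT.2.mono_right hF⟩⟩

theorem GSInv.step {F R R' : Set (HEdge A B)} (h : GSInv G F R) (hs : G.GSStep F R R') :
    GSInv G F R' := by
  obtain ⟨e, he, rfl, -⟩ := hs
  constructor
  · rintro d (hd | ⟨hdH, hdr, hd⟩) d' hd' hr hlt
    · exact Or.inl (h.closed d hd d' hd' hr hlt)
    · refine Or.inr ⟨hd', hr.trans hdr, Or.inl ?_⟩
      rcases hd with hd | ⟨rfl, -⟩
      · exact hd.trans hlt
      · exact hlt
  · rintro T hT d hdT (hdR | ⟨hdH, hdr, hd | ⟨rfl, hF⟩⟩)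
    · exact h.disjoint T hT d hdT hdR
    -- The proposed edge `e` would block `T`: the edges of `T` are undeleted, so none is better for
    -- the proposer than `e`, and the receiver prefers `e` to `d`.
    · refine hT.1.2 e ⟨he.1, fun e' he' hl => ?_, fun e' he' hr => ?_⟩
      · have hle := he.2.2 e' (hT.1.1.1 he') (h.disjoint T hT e' he') hl
        refine lt_of_le_of_ne hle fun hk => ?_
        have := leftKey_inj he.1 (hT.1.1.1 he') hl.symm hk
        subst this
        have := hT.1.1.2.2 e he' d hdT hdr.symm
        subst this
        exact lt_irrefl _ hd
      · have := hT.1.1.2.2 e' he' d hdT (hr.trans hdr.symm)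
        rwa [this]
    · exact Set.disjoint_left.1 hT.2 hdT hF

theorem GSInv.run {F R R' : Set (HEdge A B)} (h : GSInv G F R) (hr : G.GSRun F R R') :
    GSInv G F R' := by
  have := hr.1
  clear hr
  induction this with
  | refl => exact h
  | tail _ hs ih => exact ih.step hs

/-- A final state of a successful execution. -/
structure Final (G : Marriage A B) (F R : Set (HEdge A B)) : Prop extends GSInv G F R where
  no_step : ∀ R', ¬ G.GSStep F R R'
  succeeds : G.Succeeds R

namespace Final

variable {F R : Set (HEdge A B)}

/-- A step has to enlarge the state, so in a final state everything that a held edge would delete is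
already deleted. -/
theorem not_mem_deleted (h : Final G F R) {e e' : HEdge A B} (he : e ∈ G.held R)
    (hH : e' ∈ G.HEdges) (hr : e'.right = e.right)
    (hk : G.rightKey e < G.rightKey e' ∨ (e' = e ∧ e ∈ F)) : e' ∈ R := by
  by_contra hR
  refine h.no_step _ ⟨e, he, rfl, fun heq => hR ?_⟩
  rw [← heq]
  exact Or.inr ⟨hH, hr, hk⟩

theorem held_disjoint (h : Final G F R) : Disjoint (G.held R) F :=
  Set.disjoint_left.2 fun _ he hF => he.2.1 (h.not_mem_deleted he he.1 rfl (Or.inr ⟨rfl, hF⟩))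

theorem isHMatching (h : Final G F R) : G.IsHMatching (G.held R) := by
  refine ⟨fun _ he => he.1, fun e he e' he' hl => ?_, fun e he e' he' hr => ?_⟩
  · exact leftKey_inj he.1 he'.1 hl
      (le_antisymm (he.2.2 e' he'.1 he'.2.1 hl.symm) (he'.2.2 e he.1 he.2.1 hl))
  · refine rightKey_inj he.1 he'.1 hr (le_antisymm ?_ ?_) <;> refine not_lt.1 fun hlt => ?_
    · exact he.2.1 (h.not_mem_deleted he' he.1 hr (Or.inl hlt))
    · exact he'.2.1 (h.not_mem_deleted he he'.1 hr.symm (Or.inl hlt))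

theorem exists_left (h : Final G F R) (u : A ⊕ B) : ∃ e ∈ G.held R, e.left = u := h.succeeds u

/-- The partner on the right of the left copy of a vertex. -/
theorem exists_perm [Finite A] [Finite B] (h : Final G F R) :
    ∃ (π : Equiv.Perm (A ⊕ B)) (s : A ⊕ B → Bool),
      ∀ e, e ∈ G.held R ↔ e = ⟨e.left, π e.left, s e.left⟩ := by
  choose f hf hfl using h.exists_left
  have hinj : Function.Injective fun u => (f u).right := fun u v huv => by
    rw [← hfl u, ← hfl v, h.isHMatching.2.2 _ (hf u) _ (hf v) huv]
  refine ⟨Equiv.ofBijective _ (Finite.injective_iff_bijective.1 hinj), fun u => (f u).plus,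
    fun e => ⟨fun he => ?_, fun he => ?_⟩⟩
  · have : e = f e.left := h.isHMatching.2.1 _ he _ (hf e.left) (hfl _).symm
    exact HEdge.ext rfl (congrArg HEdge.right this :) (congrArg HEdge.plus this :)
  · have : e = f e.left := by
      rw [he]
      exact HEdge.ext (hfl _).symm rfl rfl
    rw [this]; exact hf _

/-- A blocking edge must have been deleted, since its left end holds its best remaining edge.
Deletions are closed downwards at the right end, so the worse edge held there would be deleted too.
-/
theorem hStable [Finite A] [Finite B] (h : Final G F R) : G.HStable (G.held R) := by
  refine ⟨h.isHMatching, fun e he => ?_⟩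
  obtain ⟨π, s, hπ⟩ := h.exists_perm
  have heR : e ∈ R := by
    by_contra hR
    obtain ⟨d, hd, hdl⟩ := h.exists_left e.left
    exact absurd (he.2.1 d hd hdl) (not_lt.2 (hd.2.2 e he.1 hR hdl.symm))
  obtain ⟨d, hd, hdr⟩ : ∃ d ∈ G.held R, d.right = e.right :=
    ⟨⟨π.symm e.right, e.right, s (π.symm e.right)⟩, (hπ _).2 (by simp), rfl⟩
  exact hd.2.1 (h.closed e heR d hd.1 hdr (he.2.2 d hd hdr))

theorem isLeftOptimal [Finite A] [Finite B] (h : Final G F R) :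
    G.IsLeftOptimal (G.stableAvoiding F) (G.held R) := by
  refine ⟨⟨h.hStable, h.held_disjoint⟩, fun T hT e he => ?_⟩
  obtain ⟨d, hd, hdl⟩ := h.exists_left e.left
  exact ⟨d, hd, hdl, hd.2.2 e (hT.1.1.1 he) (h.disjoint T hT e he) hdl.symm⟩

/-- Right vertices are matched in the final matching at most as well as in any stable matching
avoiding the forbidden edges. -/
theorem right_le (h : Final G F R) {T : Set (HEdge A B)} (hT : T ∈ G.stableAvoiding F)
    {e d : HEdge A B} (he : e ∈ G.held R) (hd : d ∈ T) (hr : d.right = e.right) :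
    G.rightKey d ≤ G.rightKey e := by
  by_contra hlt
  rw [not_le] at hlt
  refine hT.1.2 e ⟨he.1, fun e' he' hl => ?_, fun e' he' hr' => ?_⟩
  · refine lt_of_le_of_ne (he.2.2 e' (hT.1.1.1 he') (h.disjoint T hT e' he') hl) fun hk => ?_
    have := leftKey_inj he.1 (hT.1.1.1 he') hl.symm hk
    subst this
    have := hT.1.1.2.2 e he' d hd hr.symm
    subst this
    exact lt_irrefl _ hlt
  · rwa [hT.1.1.2.2 e' he' d hd (hr'.trans hr.symm)]

theorem left_le (h : Final G F R) {T : Set (HEdge A B)} (hT : T ∈ G.stableAvoiding F)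
    {e d : HEdge A B} (he : e ∈ G.held R) (hd : d ∈ T) (hl : d.left = e.left) :
    G.leftKey e ≤ G.leftKey d :=
  he.2.2 d (hT.1.1.1 hd) (h.disjoint T hT d hd) hl

end Final

theorem Reaches.final {F R : Set (HEdge A B)} {Z : Set (A ⊕ B)} (h : G.Reaches F R Z) :
    Final G F R := by
  induction h with
  | init R hrun hs => exact ⟨(GSInv.empty _).run hrun, hrun.2, hs⟩
  | iter F R R' Z v _ _ _ hrun hs ih =>
    exact ⟨(ih.toGSInv.mono Set.subset_union_left).run hrun, hrun.2, hs⟩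

/-! ### Partner functions -/

open Classical in
/-- The partner of a vertex in a matching; an unmatched vertex is its own partner. -/
noncomputable def partner (M : Set (A × B)) : A ⊕ B → A ⊕ B
  | .inl a => if h : ∃ b, (a, b) ∈ M then .inr h.choose else .inl a
  | .inr b => if h : ∃ a, (a, b) ∈ M then .inl h.choose else .inr b

/-- Partner functions of matchings. -/
structure Pairing (G : Marriage A B) (p : A ⊕ B → A ⊕ B) : Prop where
  invol : ∀ u, p (p u) = u
  opt : ∀ u, G.Opt u (p u)

/-- The matching with a given partner function. -/
def ofPartner (p : A ⊕ B → A ⊕ B) : Set (A × B) := {x | p (.inl x.1) = .inr x.2}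

theorem partner_inl_iff {M : Set (A × B)} (hM : G.IsMatching M) {a : A} {b : B} :
    partner M (.inl a) = .inr b ↔ (a, b) ∈ M := by
  simp only [partner]
  split_ifs with h
  · rw [Sum.inr.injEq]
    exact ⟨fun hb => hb ▸ h.choose_spec, fun hb => hM.2.1 _ _ _ h.choose_spec hb⟩
  · simp only [false_iff]
    exact fun hb => h ⟨b, hb⟩

theorem partner_inr_iff {M : Set (A × B)} (hM : G.IsMatching M) {a : A} {b : B} :
    partner M (.inr b) = .inl a ↔ (a, b) ∈ M := by
  simp only [partner]
  split_ifs with h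
  · rw [Sum.inl.injEq]
    exact ⟨fun hb => hb ▸ h.choose_spec, fun hb => hM.2.2 _ _ _ h.choose_spec hb⟩
  · simp only [false_iff]
    exact fun hb => h ⟨a, hb⟩

theorem partner_inl_self_iff {M : Set (A × B)} {a a' : A} :
    partner M (.inl a) = .inl a' ↔ a = a' ∧ ∀ b, (a, b) ∉ M := by
  simp only [partner]
  split_ifs with h
  · simp only [false_iff, not_and]
    exact fun _ hb => hb _ h.choose_spec
  · push Not at h
    simp [h]

theorem partner_inr_self_iff {M : Set (A × B)} {b b' : B} :
    partner M (.inr b) = .inr b' ↔ b = b' ∧ ∀ a, (a, b) ∉ M := by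
  simp only [partner]
  split_ifs with h
  · simp only [false_iff, not_and]
    exact fun _ hb => hb _ h.choose_spec
  · push Not at h
    simp [h]

theorem IsMatching.pairing {M : Set (A × B)} (hM : G.IsMatching M) : G.Pairing (partner M) := by
  constructor
  · rintro (a | b)
    · rcases h : partner M (.inl a) with a' | b
      · obtain ⟨rfl, -⟩ := partner_inl_self_iff.1 h
        exact h
      · exact (partner_inr_iff hM).2 ((partner_inl_iff hM).1 h)
    · rcases h : partner M (.inr b) with a | b'
      · exact (partner_inl_iff hM).2 ((partner_inr_iff hM).1 h)
      · obtain ⟨rfl, -⟩ := partner_inr_self_iff.1 h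
        exact h
  · rintro (a | b)
    · rcases h : partner M (.inl a) with a' | b
      · exact Or.inl (by rw [(partner_inl_self_iff.1 h).1])
      · exact Or.inr (hM.1 _ _ ((partner_inl_iff hM).1 h))
    · rcases h : partner M (.inr b) with a | b'
      · exact Or.inr (hM.1 _ _ ((partner_inr_iff hM).1 h))
      · exact Or.inl (by rw [(partner_inr_self_iff.1 h).1])

namespace Pairing

variable {p : A ⊕ B → A ⊕ B}

theorem injective (hp : G.Pairing p) : Function.Injective p := fun u v h => by
  rw [← hp.invol u, h, hp.invol]

theorem eq_comm (hp : G.Pairing p) {u v : A ⊕ B} : p u = v ↔ p v = u :=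
  ⟨fun h => by rw [← h, hp.invol], fun h => by rw [← h, hp.invol]⟩

theorem eq_self_of_inl (hp : G.Pairing p) {a a' : A} (h : p (.inl a) = .inl a') : a' = a := by
  have := hp.opt (.inl a)
  rw [h] at this
  rcases this with h' | h'
  · exact Sum.inl_injective h'
  · exact h'.elim

theorem eq_self_of_inr (hp : G.Pairing p) {b b' : B} (h : p (.inr b) = .inr b') : b' = b := by
  have := hp.opt (.inr b)
  rw [h] at this
  rcases this with h' | h'
  · exact Sum.inr_injective h'
  · exact h'.elim

theorem isMatching (hp : G.Pairing p) : G.IsMatching (ofPartner p) := by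
  refine ⟨fun a b h => ?_, fun a b b' h h' => ?_, fun a a' b h h' => ?_⟩
  · have := hp.opt (.inl a)
    rw [show p (.inl a) = .inr b from h] at this
    exact this.vadj (by simp)
  · exact Sum.inr_injective (h.symm.trans h')
  · exact Sum.inl_injective (hp.injective (h.trans h'.symm))

theorem partner_ofPartner (hp : G.Pairing p) : partner (ofPartner p) = p := by
  funext u
  rcases u with a | b
  · rcases h : p (.inl a) with a' | b
    · obtain rfl := hp.eq_self_of_inl h
      exact partner_inl_self_iff.2 ⟨rfl, fun b hb => by
        rw [show p (.inl a') = .inr b from hb] at h; simp at h⟩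
    · exact (partner_inl_iff hp.isMatching).2 h
  · rcases h : p (.inr b) with a | b'
    · exact (partner_inr_iff hp.isMatching).2 (hp.eq_comm.1 h)
    · obtain rfl := hp.eq_self_of_inr h
      exact partner_inr_self_iff.2 ⟨rfl, fun a ha => by
        rw [hp.eq_comm.1 (show p (.inl a) = .inr b' from ha)] at h; simp at h⟩

end Pairing

/-! ### Votes -/

variable (G) in
open Classical in
/-- The vote of `u` for `v` against `w`. -/
noncomputable def vote (u v w : A ⊕ B) : ℤ :=
  if G.rank u v < G.rank u w then 1 else if G.rank u w < G.rank u v then -1 else 0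

theorem vote_self (u v : A ⊕ B) : G.vote u v v = 0 := by simp [vote]

theorem vote_eq_one {u v w : A ⊕ B} (h : G.rank u v < G.rank u w) : G.vote u v w = 1 := by
  simp [vote, h]

theorem vote_eq_neg_one {u v w : A ⊕ B} (h : G.rank u w < G.rank u v) : G.vote u v w = -1 := by
  simp [vote, h, h.not_gt]

theorem vote_eq_one_iff {u v w : A ⊕ B} : G.vote u v w = 1 ↔ G.rank u v < G.rank u w := by
  unfold vote; split_ifs <;> simp_all

theorem vote_swap (u v w : A ⊕ B) : G.vote u w v = - G.vote u v w := by
  rcases lt_trichotomy (G.rank u v) (G.rank u w) with h | h | h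
  · rw [vote_eq_one h, vote_eq_neg_one h]
  · simp [vote, h]
  · rw [vote_eq_one h, vote_eq_neg_one h, neg_neg]

theorem vote_le_one (u v w : A ⊕ B) : G.vote u v w ≤ 1 := by
  unfold vote; split_ifs <;> simp

theorem neg_one_le_vote (u v w : A ⊕ B) : -1 ≤ G.vote u v w := by
  unfold vote; split_ifs <;> simp

theorem vote_of_ne {u v w : A ⊕ B} (hv : G.Opt u v) (hw : G.Opt u w) (h : v ≠ w) :
    G.vote u v w = 1 ∨ G.vote u v w = -1 := by
  rcases lt_trichotomy (G.rank u v) (G.rank u w) with h' | h' | h'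
  · exact Or.inl (vote_eq_one h')
  · exact absurd (rank_inj hv hw h') h
  · exact Or.inr (vote_eq_neg_one h')

theorem vote_self_right {u v : A ⊕ B} (h : G.VAdj u v) : G.vote u v u = 1 :=
  vote_eq_one (by rw [rank_self]; exact rank_lt_top h)

theorem agentPrefers_iff {M N : Set (A × B)} (hM : G.IsMatching M) (hN : G.IsMatching N) (a : A) :
    G.AgentPrefers M N a ↔
      G.rank (.inl a) (partner M (.inl a)) < G.rank (.inl a) (partner N (.inl a)) := by
  rcases h : partner M (.inl a) with a' | b
  · obtain ⟨rfl, hu⟩ := partner_inl_self_iff.1 h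
    rw [rank_self]
    simp only [not_top_lt, iff_false]
    rintro ⟨b, hb, -⟩
    exact hu b hb
  · have hb := (partner_inl_iff hM).1 h
    have e : G.AgentPrefers M N a ↔ ∀ b', (a, b') ∈ N → G.rankA a b < G.rankA a b' :=
      ⟨fun ⟨b₁, hb₁, h₁⟩ => by rwa [hM.2.1 _ _ _ hb hb₁], fun h₁ => ⟨b, hb, h₁⟩⟩
    rw [e]
    rcases h' : partner N (.inl a) with a' | b'
    · obtain ⟨rfl, hu⟩ := partner_inl_self_iff.1 h'
      rw [rank_self]
      exact ⟨fun _ => rank_lt_top (hM.1 _ _ hb : G.VAdj (.inl a) (.inr b)),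
        fun _ b' hb' => absurd hb' (hu b')⟩
    · have hb' := (partner_inl_iff hN).1 h'
      simp only [rank, Nat.cast_lt]
      exact ⟨fun h => h _ hb', fun h b₂ hb₂ => by rwa [hN.2.1 _ _ _ hb₂ hb']⟩

theorem jobPrefers_iff {M N : Set (A × B)} (hM : G.IsMatching M) (hN : G.IsMatching N) (b : B) :
    G.JobPrefers M N b ↔
      G.rank (.inr b) (partner M (.inr b)) < G.rank (.inr b) (partner N (.inr b)) := by
  rcases h : partner M (.inr b) with a | b'
  swap
  · obtain ⟨rfl, hu⟩ := partner_inr_self_iff.1 h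
    rw [rank_self]
    simp only [not_top_lt, iff_false]
    rintro ⟨a, ha, -⟩
    exact hu a ha
  · have ha := (partner_inr_iff hM).1 h
    have e : G.JobPrefers M N b ↔ ∀ a', (a', b) ∈ N → G.rankB b a < G.rankB b a' :=
      ⟨fun ⟨a₁, ha₁, h₁⟩ => by rwa [hM.2.2 _ _ _ ha ha₁], fun h₁ => ⟨a, ha, h₁⟩⟩
    rw [e]
    rcases h' : partner N (.inr b) with a' | b'
    · have ha' := (partner_inr_iff hN).1 h'
      simp only [rank, Nat.cast_lt]
      exact ⟨fun h => h _ ha', fun h a₂ ha₂ => by rwa [hN.2.2 _ _ _ ha₂ ha']⟩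
    · obtain ⟨rfl, hu⟩ := partner_inr_self_iff.1 h'
      rw [rank_self]
      exact ⟨fun _ => rank_lt_top (hM.1 _ _ ha : G.VAdj (.inr b) (.inl a)),
        fun _ a' ha' => absurd ha' (hu a')⟩

theorem ncard_sub_ncard_eq_sum_vote {ι : Type*} [Fintype ι] (f : ι → A ⊕ B)
    (p q : A ⊕ B → A ⊕ B) :
    ({i | G.rank (f i) (p (f i)) < G.rank (f i) (q (f i))}.ncard : ℤ) -
      ({i | G.rank (f i) (q (f i)) < G.rank (f i) (p (f i))}.ncard : ℤ) =
      ∑ i, G.vote (f i) (p (f i)) (q (f i)) := by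
  classical
  rw [Set.ncard_eq_toFinset_card', Set.ncard_eq_toFinset_card']
  simp only [Set.toFinset_ofPred, Finset.card_filter]
  push_cast
  rw [← Finset.sum_sub_distrib]
  refine Finset.sum_congr rfl fun i _ => ?_
  rcases lt_trichotomy (G.rank (f i) (p (f i))) (G.rank (f i) (q (f i))) with h | h | h
  · rw [vote_eq_one h]; simp [h, h.not_gt]
  · simp [vote, h]
  · rw [vote_eq_neg_one h]; simp [h, h.not_gt]

/-- Either `u` and `v` are partners and both votes vanish, or both votes are ±1. This parity yields
integral witnesses and their constancy modulo 2 on components. -/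
theorem even_vote_add_vote {p : A ⊕ B → A ⊕ B} (hp : G.Pairing p) {u v : A ⊕ B}
    (h : G.VAdj u v) : Even (G.vote u v (p u) + G.vote v u (p v)) := by
  by_cases hv : p u = v
  · rw [hp.eq_comm.1 hv, hv, vote_self, vote_self]; simp
  · have hu : p v ≠ u := fun hu => hv (hp.eq_comm.1 hu)
    rcases vote_of_ne (Or.inr h) (hp.opt u) (Ne.symm hv) with h1 | h1 <;>
      rcases vote_of_ne (Or.inr h.symm) (hp.opt v) hu.symm with h2 | h2 <;>
      rw [h1, h2] <;> decide

/-- In a bipartite graph a permutation along edges and loops carries two matchings: agents follow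
`σ` and jobs `σ⁻¹`, or the other way round. -/
theorem pairing_of_perm (σ : Equiv.Perm (A ⊕ B)) (hσ : ∀ u, G.Opt u (σ u)) :
    G.Pairing (Sum.elim (fun a => σ (.inl a)) fun b => σ.symm (.inr b)) := by
  have hσ' : ∀ u, G.Opt u (σ.symm u) := fun u => by simpa using (hσ (σ.symm u)).symm
  constructor
  · rintro (a | b)
    · rcases h : σ (.inl a) with a' | b
      · have := hσ (.inl a)
        rw [h] at this
        obtain rfl : a' = a := by
          rcases this with h | h
          · exact Sum.inl_injective h
          · exact h.elim
        simp [h]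
      · simp only [Sum.elim_inl, h, Sum.elim_inr]
        rw [← h, Equiv.symm_apply_apply]
    · rcases h : σ.symm (.inr b) with a | b'
      · simp only [Sum.elim_inl, h, Sum.elim_inr]
        rw [← h, Equiv.apply_symm_apply]
      · have := hσ' (.inr b)
        rw [h] at this
        obtain rfl : b' = b := by
          rcases this with h | h
          · exact Sum.inr_injective h
          · exact h.elim
        simp [h]
  · rintro (a | b)
    · exact hσ _
    · exact hσ' _

theorem PopularEdge.exists_partner {u v : A ⊕ B} (h : G.PopularEdge u v) :
    ∃ M, G.Popular M ∧ partner M u = v := by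
  rcases u with a | b <;> rcases v with a' | b'
  · obtain ⟨rfl, M, hM, h⟩ := h
    exact ⟨M, hM, partner_inl_self_iff.2 ⟨rfl, h⟩⟩
  · obtain ⟨M, hM, h⟩ := h
    exact ⟨M, hM, (partner_inl_iff hM.1).2 h⟩
  · obtain ⟨M, hM, h⟩ := h
    exact ⟨M, hM, (partner_inr_iff hM.1).2 h⟩
  · obtain ⟨rfl, M, hM, h⟩ := h
    exact ⟨M, hM, partner_inr_self_iff.2 ⟨rfl, h⟩⟩

theorem Popular.popularEdge {M : Set (A × B)} (hM : G.Popular M) (u : A ⊕ B) :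
    G.PopularEdge u (partner M u) := by
  rcases u with a | b
  · rcases h : partner M (.inl a) with a' | b
    · exact ⟨(partner_inl_self_iff.1 h).1, M, hM, (partner_inl_self_iff.1 h).2⟩
    · exact ⟨M, hM, (partner_inl_iff hM.1).1 h⟩
  · rcases h : partner M (.inr b) with a | b'
    · exact ⟨M, hM, (partner_inr_iff hM.1).1 h⟩
    · exact ⟨(partner_inr_self_iff.1 h).1, M, hM, (partner_inr_self_iff.1 h).2⟩

/-- The matching of `H` that contains two copies of each edge of a matching of `G`, with
superscripts given by `α`. -/
def lift (p : A ⊕ B → A ⊕ B) (α : A ⊕ B → ℤ) : Set (HEdge A B) :=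
  {e | e.right = p e.left ∧ (e.plus = true ↔ α e.left = 1)}

theorem exists_mem_lift (p : A ⊕ B → A ⊕ B) (α : A ⊕ B → ℤ) (u : A ⊕ B) :
    ∃ e ∈ lift p α, e.left = u ∧ e.right = p u :=
  ⟨⟨u, p u, decide (α u = 1)⟩, ⟨rfl, by simp⟩, rfl, rfl⟩

section Fintype

variable [Fintype A] [Fintype B]

theorem phi_sub_phi {M N : Set (A × B)} (hM : G.IsMatching M) (hN : G.IsMatching N) :
    (G.phi M N : ℤ) - G.phi N M = ∑ u, G.vote u (partner M u) (partner N u) := by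
  have h1 := ncard_sub_ncard_eq_sum_vote (G := G) Sum.inl (partner M) (partner N)
  have h2 := ncard_sub_ncard_eq_sum_vote (G := G) Sum.inr (partner M) (partner N)
  rw [Fintype.sum_sum_type, ← h1, ← h2]
  simp only [phi, phiA, agentPrefers_iff hM hN, agentPrefers_iff hN hM, jobPrefers_iff hM hN,
    jobPrefers_iff hN hM]
  push_cast
  ring

theorem popular_iff {M : Set (A × B)} : G.Popular M ↔
    G.IsMatching M ∧ ∀ q, G.Pairing q → ∑ u, G.vote u (q u) (partner M u) ≤ 0 := by
  refine and_congr_right fun hM => ⟨fun h q hq => ?_, fun h N hN => ?_⟩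
  · have h1 := phi_sub_phi hq.isMatching hM
    rw [hq.partner_ofPartner] at h1
    have := h _ hq.isMatching
    omega
  · have h1 := phi_sub_phi hN hM
    have := h _ hN.pairing
    omega

theorem Popular.sum_vote_eq_zero {M N : Set (A × B)} (hM : G.Popular M) (hN : G.Popular N) :
    ∑ u, G.vote u (partner M u) (partner N u) = 0 := by
  have h1 := phi_sub_phi hM.1 hN.1
  have h2 := hM.2 N hN.1
  have h3 := hN.2 M hM.1
  omega

/-! ### Witnesses of popularity -/

/-- A dual certificate for the popularity of the matching with partner function `p`. For `v = u`
the covering condition says that the vote of `u` for being unmatched is at most `α u`. -/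
structure IsWitness (G : Marriage A B) (p : A ⊕ B → A ⊕ B) (α : A ⊕ B → ℤ) : Prop where
  cover : ∀ u v, G.Opt u v → G.vote u v (p u) + G.vote v u (p v) ≤ α u + α v
  sum_nonpos : ∑ u, α u ≤ 0

namespace Pairing

variable {p q : A ⊕ B → A ⊕ B}

theorem sum_comp (hq : G.Pairing q) (f : A ⊕ B → ℤ) : ∑ u, f (q u) = ∑ u, f u :=
  Equiv.sum_comp (Function.Involutive.toPerm q hq.invol) f

theorem two_mul_sum_vote (hq : G.Pairing q) (p : A ⊕ B → A ⊕ B) :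
    2 * ∑ u, G.vote u (q u) (p u) =
      ∑ u, (G.vote u (q u) (p u) + G.vote (q u) u (p (q u))) := by
  rw [Finset.sum_add_distrib, two_mul, add_right_inj,
    ← hq.sum_comp fun u => G.vote u (q u) (p u)]
  simp only [hq.invol]

theorem two_mul_sum (hq : G.Pairing q) (α : A ⊕ B → ℤ) :
    2 * ∑ u, α u = ∑ u, (α u + α (q u)) := by
  rw [Finset.sum_add_distrib, two_mul, add_right_inj, hq.sum_comp]

end Pairing

namespace IsWitness

variable {p q : A ⊕ B → A ⊕ B} {α : A ⊕ B → ℤ}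

theorem sum_vote_nonpos (h : G.IsWitness p α) (hq : G.Pairing q) :
    ∑ u, G.vote u (q u) (p u) ≤ 0 := by
  have h1 := hq.two_mul_sum_vote p
  have h2 := hq.two_mul_sum α
  have h3 := Finset.sum_le_sum fun u (_ : u ∈ Finset.univ) => h.cover u (q u) (hq.opt u)
  have h4 := h.sum_nonpos
  omega

/-- Complementary slackness: if `q` ties with `p`, the covering inequalities along `q` sum to an
equality, hence each is one. -/
theorem tight (h : G.IsWitness p α) (hq : G.Pairing q)
    (h0 : ∑ u, G.vote u (q u) (p u) = 0) (u : A ⊕ B) :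
    G.vote u (q u) (p u) + G.vote (q u) u (p (q u)) = α u + α (q u) := by
  have h1 := hq.two_mul_sum_vote p
  have h2 := hq.two_mul_sum α
  have h3 := Finset.sum_le_sum fun u (_ : u ∈ Finset.univ) => h.cover u (q u) (hq.opt u)
  have h4 := h.sum_nonpos
  exact (Finset.sum_eq_sum_iff_of_le fun u (_ : u ∈ Finset.univ) =>
    h.cover u (q u) (hq.opt u)).1 (by omega) u (Finset.mem_univ u)

theorem add_partner (h : G.IsWitness p α) (hp : G.Pairing p) (u : A ⊕ B) : α u + α (p u) = 0 := by
  rw [← h.tight hp (by simp [vote_self]) u, hp.invol, vote_self, vote_self, add_zero]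

theorem neg_one_le (h : G.IsWitness p α) (u : A ⊕ B) : -1 ≤ α u := by
  have h1 := h.cover u u (Or.inl rfl)
  have h2 := neg_one_le_vote (G := G) u u (p u)
  omega

theorem le_one (h : G.IsWitness p α) (hp : G.Pairing p) (u : A ⊕ B) : α u ≤ 1 := by
  have h1 := h.add_partner hp u
  have h2 := h.neg_one_le (p u)
  omega

end IsWitness

theorem Popular.exists_witness {M : Set (A × B)} (hM : G.Popular M) :
    ∃ α, G.IsWitness (partner M) α := by
  classical
  set p := partner M with hpdef
  have hp : G.Pairing p := hM.1.pairing
  obtain ⟨hm, hpop⟩ := popular_iff.1 hM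
  have heven : ∀ u v, G.Opt u v → Even (G.vote u v (p u) + G.vote v u (p v)) := by
    rintro u v (rfl | h)
    · exact ⟨_, rfl⟩
    · exact even_vote_add_vote hp h
  -- Halving is exact by parity. Twice the weight of a permutation is the total vote for its two
  -- matchings against `p`, which is nonpositive by popularity.
  let w : A ⊕ B → A ⊕ B → ℤ := fun u v => (G.vote u v (p u) + G.vote v u (p v)) / 2
  have hw : ∀ u v, G.Opt u v → 2 * w u v = G.vote u v (p u) + G.vote v u (p v) := fun u v h =>
    Int.two_mul_ediv_two_of_even (heven u v h)
  obtain ⟨x, y, hxy, hs⟩ := exists_dual_of_perm_weight_nonpos G.Opt w (fun σ hσ => by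
    have hσ' : ∀ u, G.Opt u (σ.symm u) := fun u => by simpa using (hσ (σ.symm u)).symm
    have h1 := hpop _ (pairing_of_perm σ hσ)
    have h2 := hpop _ (pairing_of_perm σ.symm hσ')
    have h3 : 2 * ∑ u, w u (σ u) =
        ∑ u, G.vote u (σ u) (p u) + ∑ u, G.vote u (σ.symm u) (p u) := by
      rw [Finset.mul_sum, Finset.sum_congr rfl fun u _ => hw u _ (hσ u), Finset.sum_add_distrib,
        add_right_inj, ← Equiv.sum_comp σ fun u => G.vote u (σ.symm u) (p u)]
      simp
    rw [← hpdef] at h1 h2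
    simp only [Fintype.sum_sum_type, Sum.elim_inl, Sum.elim_inr, Equiv.symm_symm] at h1 h2 h3
    rw [Fintype.sum_sum_type]
    omega)
  -- The weight is symmetric, so adding the dual constraints for `(u, v)` and `(v, u)` gives the
  -- covering condition for `x + y`.
  refine ⟨fun u => x u + y u, fun u v h => ?_, by rwa [Finset.sum_add_distrib]⟩
  have h1 := hxy u v h
  have h2 := hxy v u h.symm
  have h3 := hw u v h
  have h4 := hw v u h.symm
  omega

theorem IsWitness.popular {p : A ⊕ B → A ⊕ B} {α : A ⊕ B → ℤ} (h : G.IsWitness p α)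
    (hp : G.Pairing p) : G.Popular (ofPartner p) :=
  popular_iff.2 ⟨hp.isMatching, fun q hq => by
    rw [hp.partner_ofPartner]; exact h.sum_vote_nonpos hq⟩

/-- The parity of a witness is constant on the components of the popular subgraph. -/
theorem IsWitness.even_iff_of_mem_component {N : Set (A × B)} (hN : G.Popular N)
    {α : A ⊕ B → ℤ} (h : G.IsWitness (partner N) α) {u v : A ⊕ B} (huv : v ∈ G.component u) :
    Even (α u) ↔ Even (α v) := by
  have edge : ∀ u v, G.PopularEdge u v → u ≠ v → (Even (α u) ↔ Even (α v)) := by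
    intro u v huv hne
    obtain ⟨M, hM, rfl⟩ := huv.exists_partner
    have h1 := h.tight hM.1.pairing (hM.sum_vote_eq_zero hN) u
    have h2 := even_vote_add_vote hN.1.pairing ((hM.1.pairing.opt u).vadj hne.symm)
    rw [h1] at h2
    exact Int.even_add.1 h2
  obtain ⟨w⟩ := huv
  induction w with
  | nil => rfl
  | cons hadj _ ih =>
    refine Iff.trans ?_ ih
    obtain ⟨hne, hp | hp⟩ := (SimpleGraph.fromRel_adj _ _ _).1 hadj
    · exact edge _ _ hp hne
    · exact (edge _ _ hp hne.symm).symm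

/-! ### The stable matching of `H` induced by a popular matching -/

/-- A blocking copy of an edge would make its vote sum exceed `α u + α v`. Loops cannot block, being
last for their left end. Values 0 and -1 both receive the superscript `-`. -/
theorem IsWitness.hStable_lift {p : A ⊕ B → A ⊕ B} {α : A ⊕ B → ℤ} (h : G.IsWitness p α)
    (hp : G.Pairing p) : G.HStable (lift p α) := by
  refine ⟨⟨?_, ?_, ?_⟩, ?_⟩
  · rintro e ⟨hr, hs⟩
    by_cases hu : p e.left = e.left
    · refine Or.inr ⟨by rw [hr, hu], ?_⟩
      rw [← Bool.not_eq_true, hs]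
      have := h.add_partner hp e.left
      rw [hu] at this
      omega
    · left
      rw [hr]
      exact (hp.opt _).vadj hu
  · rintro e ⟨hr, hs⟩ e' ⟨hr', hs'⟩ hl
    refine HEdge.ext hl (by rw [hr, hr', hl]) (Bool.eq_iff_iff.2 (by rw [hs, hs', hl]))
  · rintro e ⟨hr, hs⟩ e' ⟨hr', hs'⟩ hrr
    have hl : e.left = e'.left := hp.injective (by rw [← hr, ← hr', hrr])
    refine HEdge.ext hl hrr (Bool.eq_iff_iff.2 (by rw [hs, hs', hl]))
  · rintro ⟨u, v, s⟩ ⟨he, hl, hr⟩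
    obtain ⟨e, heT, rfl, hev⟩ := exists_mem_lift p α u
    obtain ⟨d, hdT, hdl, hdv⟩ := exists_mem_lift p α (p v)
    rw [hp.invol] at hdv
    have hl := (leftKey_lt_iff G).1 (hl e heT rfl)
    have hr := (rightKey_lt_iff G).1 (hr d hdT hdv)
    have hes := heT.2
    have hds := hdT.2
    have hv := h.add_partner hp v
    have b1 := h.le_one hp v
    have b2 := h.le_one hp e.left
    rw [hdl] at hds
    simp only [hev, hdv, hdl] at hl hr he
    rcases he with he | ⟨he, hs⟩
    · change G.VAdj e.left v at he
      have hc := h.cover _ _ (Or.inr he)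
      have v1 := neg_one_le_vote (G := G) e.left v (p e.left)
      have v2 := neg_one_le_vote (G := G) v e.left (p v)
      rw [← vote_eq_one_iff] at hl hr
      -- An end that prefers the blocking edge without a better superscript must vote 1 for it. The
      -- superscripts bound `α e.left` and `α v = -α (p v)`, contradicting `hc` in each case.
      cases s <;> cases h1 : e.plus <;> cases h2 : d.plus <;> simp_all <;> omega
    · simp only at he hs
      subst he hs
      rw [rank_self] at hl
      simp at hl

end Fintype

/-! ### Validity and popularity among agents -/

/-- In an `A`-popular matching, a job that some agent prefers to its assignment is matched to an
agent that ranks it first. -/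
theorem APopular.exists_isF [Finite A] {N : Set (A × B)} (hN : G.APopular N) {x : A} {c : B}
    (hadj : G.Adj x c) (hx : ∀ b, (x, b) ∈ N → G.rankA x c < G.rankA x b) :
    ∃ y, (y, c) ∈ N ∧ G.IsF y c := by
  obtain ⟨hm, hpop⟩ := hN
  by_cases hc : ∃ y, (y, c) ∈ N
  · obtain ⟨y, hy⟩ := hc
    refine ⟨y, hy, hm.1 _ _ hy, ?_⟩
    by_contra! hd
    obtain ⟨d, hyd, hlt⟩ := hd
    have hxy : x ≠ y := by
      rintro rfl
      exact lt_irrefl _ (hx c hy)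
    have hcd : c ≠ d := by
      rintro rfl
      exact lt_irrefl _ hlt
    -- Promote `x` to `c` and the evicted `y` to a better job `d`. Two agents gain, and only the
    -- former holder of `d` can lose.
    let N' : Set (A × B) := {e | (e ∈ N ∧ e.1 ≠ x ∧ e.1 ≠ y ∧ e.2 ≠ c ∧ e.2 ≠ d) ∨
      e = (x, c) ∨ e = (y, d)}
    have hm' : G.IsMatching N' := by
      refine ⟨?_, ?_, ?_⟩
      · rintro a b (h | h | h)
        · exact hm.1 _ _ h.1
        · obtain ⟨rfl, rfl⟩ := Prod.mk.inj h; exact hadj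
        · obtain ⟨rfl, rfl⟩ := Prod.mk.inj h; exact hyd
      · intro a b b' h h'
        have := hm.2.1 a b b'
        simp only [N', Set.mem_ofPred_eq, Prod.mk.injEq] at h h'
        grind
      · intro a a' b h h'
        have := hm.2.2 a a' b
        simp only [N', Set.mem_ofPred_eq, Prod.mk.injEq] at h h'
        grind
    have h1 : G.phiA N N' ≤ 1 := by
      refine le_trans (Set.ncard_le_ncard (t := {a | (a, d) ∈ N}) ?_) ?_
      · rintro a ⟨b, hb, hlt'⟩
        by_cases hax : a = x
        · subst hax
          exact absurd (hlt' c (Or.inr (Or.inl rfl))) (hx b hb).not_gt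
        by_cases hay : a = y
        · subst hay
          rw [hm.2.1 _ _ _ hb hy] at hlt'
          exact absurd (hlt' d (Or.inr (Or.inr rfl))) hlt.not_gt
        by_cases hbc : b = c
        · subst hbc
          exact absurd (hm.2.2 _ _ _ hb hy) hay
        by_cases hbd : b = d
        · subst hbd
          exact hb
        · exact absurd (hlt' b (Or.inl ⟨hb, hax, hay, hbc, hbd⟩)) (lt_irrefl _)
      · exact Set.ncard_le_one_iff_subsingleton.2 fun _ h _ h' => hm.2.2 _ _ _ h h'
    have h2 : 2 ≤ G.phiA N' N := by
      rw [← Set.ncard_pair hxy]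
      refine Set.ncard_le_ncard ?_
      rintro a (rfl | rfl)
      · exact ⟨c, Or.inr (Or.inl rfl), hx⟩
      · exact ⟨d, Or.inr (Or.inr rfl), fun b hb => by rwa [hm.2.1 _ _ _ hb hy]⟩
    have := hpop N' hm'
    omega
  · exfalso
    push Not at hc
    let N' : Set (A × B) := {e | (e ∈ N ∧ e.1 ≠ x) ∨ e = (x, c)}
    have hm' : G.IsMatching N' := by
      refine ⟨?_, ?_, ?_⟩
      · rintro a b (h | h)
        · exact hm.1 _ _ h.1
        · obtain ⟨rfl, rfl⟩ := Prod.mk.inj h; exact hadj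
      · intro a b b' h h'
        have := hm.2.1 a b b'
        simp only [N', Set.mem_ofPred_eq, Prod.mk.injEq] at h h'
        grind
      · intro a a' b h h'
        have := hm.2.2 a a' b
        simp only [N', Set.mem_ofPred_eq, Prod.mk.injEq] at h h'
        grind
    have h1 : G.phiA N N' = 0 := by
      rw [phiA, Set.ncard_eq_zero, Set.eq_empty_iff_forall_notMem]
      rintro a ⟨b, hb, hlt'⟩
      by_cases hax : a = x
      · subst hax
        exact absurd (hlt' c (Or.inr rfl)) (hx b hb).not_gt
      · exact absurd (hlt' b (Or.inl ⟨hb, hax⟩)) (lt_irrefl _)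
    have h2 : 0 < G.phiA N' N :=
      (Set.ncard_pos).2 ⟨x, c, Or.inr rfl, hx⟩
    have := hpop N' hm'
    omega

theorem IsF.prefers {x : A} {c : B} (h : G.IsF x c) {b : B} (hb : G.Adj x b) (hne : b ≠ c) :
    G.rankA x c < G.rankA x b :=
  lt_of_le_of_ne (h.2 b hb) fun he => hne (G.rankA_inj _ _ _ hb h.1 he.symm)

theorem IsF.unique {x : A} {b c : B} (h : G.IsF x c) (h' : G.IsF x b) : b = c :=
  G.rankA_inj _ _ _ h'.1 h.1 (le_antisymm (h'.2 _ h.1) (h.2 _ h'.1))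

theorem IsS.unique {x : A} {b c : B} (h : G.IsS x c) (h' : G.IsS x b) : b = c :=
  G.rankA_inj _ _ _ h'.1 h.1 (le_antisymm (h'.2.2 _ h.1 h.2.1) (h.2.2 _ h'.1 h'.2.1))

theorem Valid.isF {a : A} {b : B} (h : G.Valid (.inl a) (.inr b)) (hb : G.IsTopJob b) :
    G.IsF a b := h.resolve_right fun h => h.2.1 hb

theorem Valid.isS {a : A} {b : B} (h : G.Valid (.inl a) (.inr b)) (hb : ¬ G.IsTopJob b) :
    G.IsS a b := h.resolve_left fun h => hb ⟨a, h⟩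

theorem Valid.symm {u v : A ⊕ B} (h : G.Valid u v) : G.Valid v u := by
  rcases u with a | b <;> rcases v with a' | b'
  · obtain ⟨rfl, h⟩ := h; exact ⟨rfl, h⟩
  · exact h
  · exact h
  · obtain ⟨rfl, h⟩ := h; exact ⟨rfl, h⟩

theorem APopular.valid [Finite A] {N : Set (A × B)} (hN : G.APopular N) (u : A ⊕ B) :
    G.Valid u (partner N u) := by
  have hm := hN.1
  have edge : ∀ a b, (a, b) ∈ N → G.IsF a b ∨ G.IsS a b := by
    intro a b hab
    by_cases ht : G.IsTopJob b
    · left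
      obtain ⟨a', ha'⟩ := ht
      by_cases haa : a' = a
      · rwa [← haa]
      · obtain ⟨y, hy, hyF⟩ := hN.exists_isF ha'.1 fun c hc =>
          ha'.prefers (hm.1 _ _ hc) fun hcb => haa (hm.2.2 _ _ _ (hcb ▸ hc) hab)
        rwa [hm.2.2 _ _ _ hab hy]
    · refine Or.inr ⟨hm.1 _ _ hab, ht, fun b' hb' ht' => ?_⟩
      by_contra hlt
      obtain ⟨y, -, hyF⟩ := hN.exists_isF hb' fun c hc => by
        rw [hm.2.1 _ _ _ hc hab]; exact not_le.1 hlt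
      exact ht' ⟨y, hyF⟩
  rcases u with a | b
  · rcases h : partner N (.inl a) with a' | b
    · obtain ⟨rfl, hu⟩ := partner_inl_self_iff.1 h
      refine ⟨rfl, fun b hb => ?_⟩
      obtain ⟨y, -, hy⟩ := hN.exists_isF hb fun c hc => absurd hc (hu c)
      exact ⟨y, hy⟩
    · exact edge a b ((partner_inl_iff hm).1 h)
  · rcases h : partner N (.inr b) with a | b'
    · exact edge a b ((partner_inr_iff hm).1 h)
    · obtain ⟨rfl, hu⟩ := partner_inr_self_iff.1 h
      refine ⟨rfl, fun ⟨a, ha⟩ => ?_⟩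
      obtain ⟨y, hy, -⟩ := hN.exists_isF ha.1 fun c hc =>
        ha.prefers (hm.1 _ _ hc) fun hcb => hu a (hcb ▸ hc)
      exact hu y hy

/-- A matching all of whose edges and self-loops are valid is `A`-popular. -/
theorem aPopular_of_valid [Finite A] {M : Set (A × B)} (hM : G.IsMatching M)
    (hv : ∀ u, G.Valid u (partner M u)) : G.APopular M := by
  refine ⟨hM, fun N hN => ?_⟩
  -- An agent can improve on a valid assignment only with a top job `b`. The agent holding `b` in
  -- `M` ranks it first and loses it, so gains inject into losses.
  have key : ∀ a, G.AgentPrefers N M a →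
      ∃ a' b, (a, b) ∈ N ∧ (a', b) ∈ M ∧ G.AgentPrefers M N a' := by
    rintro a ⟨b, hb, hlt⟩
    have hadj := hN.1 _ _ hb
    have htop : G.IsTopJob b := by
      by_contra ht
      have hva := hv (.inl a)
      rcases h : partner M (.inl a) with a' | c
      · rw [h] at hva
        exact ht (hva.2 b hadj)
      · rw [h] at hva
        have hlt' := hlt c ((partner_inl_iff hM).1 h)
        rcases hva with hF | hS
        · exact absurd (hF.2 b hadj) hlt'.not_ge
        · exact absurd (hS.2.2 b hadj ht) hlt'.not_ge
    have hvb := hv (.inr b)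
    rcases h : partner M (.inr b) with a' | b'
    · rw [h] at hvb
      have hF : G.IsF a' b := hvb.symm.isF htop
      have hM' := (partner_inr_iff hM).1 h
      refine ⟨a', b, hb, hM', b, hM', fun c hc => hF.prefers (hN.1 _ _ hc) ?_⟩
      rintro rfl
      obtain rfl := hN.2.2 _ _ _ hb hc
      exact lt_irrefl _ (hlt c hM')
    · rw [h] at hvb
      exact absurd htop hvb.2
  choose! f g hg hf hfp using key
  refine Set.ncard_le_ncard_of_injOn f hfp fun a ha a' ha' h => ?_
  have h1 := hf a ha
  rw [h] at h1
  have h2 := hM.2.1 _ _ _ h1 (hf a' ha')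
  have h3 := hg a ha
  rw [h2] at h3
  exact hN.2.2 _ _ _ h3 (hg a' ha')

/-! ### Fully popular matchings avoid the forbidden edges -/

/-- The left end of a plus edge sees the better superscript, so by left-optimality a minus edge in
the final matching excludes a plus edge in `T`. `Final.plus_right` is the right-pessimal
counterpart. -/
theorem Final.plus_left {F R : Set (HEdge A B)} (h : Final G F R) {T : Set (HEdge A B)}
    (hT : T ∈ G.stableAvoiding F) {e d : HEdge A B} (he : e ∈ G.held R) (hd : d ∈ T)
    (hl : d.left = e.left) (hp : e.plus = false) : d.plus = false := by
  by_contra hd'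
  exact absurd (h.left_le hT he hd hl)
    (not_le.2 ((leftKey_lt_iff G).2 (Or.inl ⟨Bool.eq_true_of_not_eq_false hd', hp⟩)))

theorem Final.plus_right {F R : Set (HEdge A B)} (h : Final G F R) {T : Set (HEdge A B)}
    (hT : T ∈ G.stableAvoiding F) {e d : HEdge A B} (he : e ∈ G.held R) (hd : d ∈ T)
    (hr : d.right = e.right) (hp : e.plus = false) : d.plus = false := by
  by_contra hd'
  exact absurd (h.right_le hT he hd hr)
    (not_le.2 ((rightKey_lt_iff G).2 (Or.inl ⟨hp, Bool.eq_true_of_not_eq_false hd'⟩)))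

theorem FullyPopular.lift_mem_stableAvoiding [Fintype A] [Fintype B] {N : Set (A × B)}
    (hN : G.FullyPopular N) {α : A ⊕ B → ℤ} (hα : G.IsWitness (partner N) α)
    {F R : Set (HEdge A B)} {Z : Set (A ⊕ B)} (h : G.Reaches F R Z) :
    lift (partner N) α ∈ G.stableAvoiding F := by
  have hp := hN.1.1.pairing
  induction h with
  | init R hrun hs =>
    refine ⟨hα.hStable_lift hp, Set.disjoint_left.2 fun e he hill => hill.2 ?_⟩
    rw [he.1]
    exact ⟨hN.2.valid _, hN.1.popularEdge _⟩
  | iter F R R' Z v hprev hv hvZ hrun hs ih =>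
    refine ⟨ih.1, ih.2.union_right ?_⟩
    have hneg : ∀ e ∈ G.held R, e.plus = false → α e.left ≠ 1 ∧ α e.right ≠ -1 := by
      intro e he hplus
      obtain ⟨d, hd, hdl, -⟩ := exists_mem_lift (partner N) α e.left
      obtain ⟨d', hd', hdl', hdr'⟩ := exists_mem_lift (partner N) α (partner N e.right)
      rw [hp.invol] at hdr'
      have h1 := hprev.final.plus_left ih he hd hdl hplus
      have h2 := hprev.final.plus_right ih he hd' hdr' hplus
      rw [← Bool.not_eq_true, hd.2, hdl] at h1
      rw [← Bool.not_eq_true, hd'.2, hdl'] at h2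
      have := hα.add_partner hp e.right
      exact ⟨h1, by omega⟩
    -- A critical vertex has minus edges at both of its copies, which excludes the value 1 by one
    -- copy and -1 by the other.
    have hv0 : α v = 0 := by
      have b1 := hα.neg_one_le v
      have b2 := hα.le_one hp v
      rcases hv with ⟨a, ⟨⟨b, hb⟩, ⟨b', hb'⟩⟩, rfl⟩ | ⟨b, ⟨⟨a, ha⟩, ⟨a', ha'⟩⟩, rfl⟩
      · have h1 := (hneg _ hb rfl).1
        have h2 := (hneg _ hb' rfl).2
        simp only at h1 h2
        omega
      · have h1 := (hneg _ ha rfl).2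
        have h2 := (hneg _ ha' rfl).1
        simp only at h1 h2
        omega
    -- Parity is constant on the component, and 0 is the only even value in [-1, 1].
    have hcomp : ∀ w ∈ G.component v, α w = 0 := by
      intro w hw
      have h1 := (hα.even_iff_of_mem_component hN.1 hw).1 (by rw [hv0]; decide)
      have b1 := hα.neg_one_le w
      have b2 := hα.le_one hp w
      obtain ⟨k, hk⟩ := h1
      omega
    refine Set.disjoint_left.2 fun e he ⟨_, hplus, a, ha, hea⟩ => ?_
    have h1 := he.2.1 hplus
    have h2 := hα.add_partner hp e.left
    rw [← he.1] at h2
    have h3 := hcomp _ ha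
    rcases hea with hea | hea <;> rw [hea] at h2 <;> [rw [hea] at h1; skip] <;> omega

/-- Agents whose copies are matched to each other are unmatched in all fully popular matchings. -/
theorem FullyPopular.not_mem_of_mem_UA [Finite A] [Finite B] {N : Set (A × B)}
    (hN : G.FullyPopular N) {F R : Set (HEdge A B)} {Z : Set (A ⊕ B)} (h : G.Reaches F R Z)
    {a : A} (ha : a ∈ UA (G.held R)) (b : B) : (a, b) ∉ N := by
  have := Fintype.ofFinite A
  have := Fintype.ofFinite B
  obtain ⟨α, hα⟩ := hN.1.exists_witness
  have hT := hN.lift_mem_stableAvoiding hα h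
  intro hab
  obtain ⟨d, hd, hdl, hdr⟩ := exists_mem_lift (partner N) α (.inl a)
  rw [(partner_inl_iff hN.1.1).2 hab] at hdr
  have h1 := h.final.plus_left hT ha hd hdl rfl
  refine absurd (h.final.left_le hT ha hd hdl) (not_le.2 ((leftKey_lt_iff G).2 (Or.inr ⟨h1, ?_⟩)))
  rw [hdl, hdr, rank_self]
  exact rank_lt_top (hN.1.1.1 _ _ hab : G.VAdj (.inl a) (.inr b))

/-! ### The marked vertices -/

theorem Reaches.illegal_subset {F R : Set (HEdge A B)} {Z : Set (A ⊕ B)} (h : G.Reaches F R Z) :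
    G.illegalEdges ⊆ F := by
  induction h with
  | init => exact subset_rfl
  | iter _ _ _ _ _ _ _ _ _ _ ih => exact ih.trans Set.subset_union_left

theorem Reaches.mem_marked {F R : Set (HEdge A B)} {Z : Set (A ⊕ B)} (h : G.Reaches F R Z)
    {u v : A ⊕ B} (huv : G.popularGraph.Reachable u v) (hu : u ∈ Z) : v ∈ Z := by
  induction h with
  | init => exact hu.elim
  | iter _ _ _ _ _ _ _ _ _ _ ih => exact hu.imp ih fun h => SimpleGraph.Reachable.trans h huv

theorem Reaches.marked_iff {F R : Set (HEdge A B)} {Z : Set (A ⊕ B)} (h : G.Reaches F R Z)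
    {u v : A ⊕ B} (huv : G.PopularEdge u v) : u ∈ Z ↔ v ∈ Z := by
  by_cases hne : u = v
  · rw [hne]
  · have : G.popularGraph.Reachable u v :=
      SimpleGraph.Adj.reachable ((SimpleGraph.fromRel_adj _ _ _).2 ⟨hne, Or.inl huv⟩)
    exact ⟨h.mem_marked this, h.mem_marked this.symm⟩

theorem Reaches.forbidden_of_marked {F R : Set (HEdge A B)} {Z : Set (A ⊕ B)}
    (h : G.Reaches F R Z) {a : A} (ha : Sum.inl a ∈ Z) {e : HEdge A B} (he : e ∈ G.HEdges)
    (hplus : e.plus = true) (hea : e.left = .inl a ∨ e.right = .inl a) : e ∈ F := by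
  induction h with
  | init => exact ha.elim
  | iter _ _ _ _ _ _ _ _ _ _ ih =>
    rcases ha with ha | ha
    · exact Or.inl (ih ha)
    · exact Or.inr ⟨he, hplus, a, ha, hea⟩

/-! ### Popularity of the upper half of a stable matching of `H` -/

/-- One half of a perfect stable matching of `H` in terms of the original graph: `p` is the partner
function and `σ` gives the superscripts. -/
structure IsHalf (G : Marriage A B) (p : A ⊕ B → A ⊕ B) (σ : A ⊕ B → ℤ) : Prop where
  pairing : G.Pairing p
  cover : ∀ a b, G.Adj a b →
    G.vote (.inl a) (.inr b) (p (.inl a)) + G.vote (.inr b) (.inl a) (p (.inr b)) ≤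
      σ (.inl a) + σ (.inr b)
  add_partner : ∀ u, p u ≠ u → σ u + σ (p u) = 0
  sign : ∀ u, σ u = 1 ∨ σ u = -1
  valid : ∀ u, G.Valid u (p u)

theorem IsHalf.cover' {p : A ⊕ B → A ⊕ B} {σ : A ⊕ B → ℤ} (h : G.IsHalf p σ) {u v : A ⊕ B}
    (huv : G.VAdj u v) : G.vote u v (p u) + G.vote v u (p v) ≤ σ u + σ v := by
  rcases u with a | b <;> rcases v with a' | b'
  · exact huv.elim
  · exact h.cover _ _ huv
  · rw [add_comm, add_comm (σ _)]; exact h.cover _ _ huv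
  · exact huv.elim

theorem Pairing.exists_inr {p : A ⊕ B → A ⊕ B} (hp : G.Pairing p) {a : A} (h : p (.inl a) ≠ .inl a) :
    ∃ b, p (.inl a) = .inr b := by
  rcases h' : p (.inl a) with a' | b
  · rw [hp.eq_self_of_inl h'] at h'
    exact absurd h' h
  · exact ⟨b, rfl⟩

theorem Pairing.exists_inl {p : A ⊕ B → A ⊕ B} (hp : G.Pairing p) {b : B} (h : p (.inr b) ≠ .inr b) :
    ∃ a, p (.inl a) = .inr b := by
  rcases h' : p (.inr b) with a | b'
  · exact ⟨a, hp.eq_comm.1 h'⟩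
  · rw [hp.eq_self_of_inr h'] at h'
    exact absurd h' h

theorem vote_isF {a : A} {b : B} (h : G.IsF a b) {u : A ⊕ B} (hu : G.Opt (.inl a) u)
    (hne : u ≠ .inr b) : G.vote (.inl a) (.inr b) u = 1 := by
  refine (vote_of_ne (G := G) (Or.inr (show G.VAdj (.inl a) (.inr b) from h.1)) hu hne.symm).resolve_right fun h1 => ?_
  rw [vote_swap, neg_inj, vote_eq_one_iff] at h1
  rcases u with a' | b'
  · exact not_top_lt h1
  · refine absurd h1 (not_lt.2 (Nat.cast_le.2 (h.2 b' ?_)))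
    rcases hu with hu | hu
    · simp at hu
    · exact hu

theorem vote_isS {a : A} {b : B} (h : G.IsS a b) {u : A ⊕ B} (hu : G.Valid (.inl a) u)
    (hadj : G.Opt (.inl a) u) (hne : u ≠ .inr b) : G.vote (.inl a) (.inr b) u = -1 := by
  rcases u with a' | b'
  · exact absurd (hu.2 b h.1) h.2.1
  · rcases hu with hF | hS
    · rw [vote_swap, vote_isF hF (Or.inr (show G.VAdj (.inl a) (.inr b) from h.1)) fun he => hne he.symm]
    · exact absurd (by rw [hS.unique h]) hne

/-- The two halves of a perfect stable matching of `H`, in terms of the original graph. -/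
structure IsHalves (G : Marriage A B) (p q : A ⊕ B → A ⊕ B) (σ τ : A ⊕ B → ℤ) : Prop where
  upper : G.IsHalf p σ
  lower : G.IsHalf q τ
  self_iff : ∀ u, p u = u ↔ q u = u
  self_inl : ∀ a, p (.inl a) = .inl a → σ (.inl a) = -1 ∧ τ (.inl a) = 1
  self_inr : ∀ b, p (.inr b) = .inr b → σ (.inr b) = 1 ∧ τ (.inr b) = -1

namespace IsHalves

variable {p q : A ⊕ B → A ⊕ B} {σ τ : A ⊕ B → ℤ}

/-- A job matched in one half is matched in the other half. -/
theorem exists_lower (h : G.IsHalves p q σ τ) {a : A} {b : B} (hp : p (.inl a) = .inr b) :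
    ∃ a', q (.inl a') = .inr b :=
  Pairing.exists_inl h.lower.pairing fun hb => by
    have := (h.self_iff _).2 hb
    rw [h.upper.pairing.eq_comm.1 hp] at this
    simp at this

theorem exists_upper (h : G.IsHalves p q σ τ) {a : A} {b : B} (hq : q (.inl a) = .inr b) :
    ∃ a', p (.inl a') = .inr b :=
  Pairing.exists_inl h.upper.pairing fun hb => by
    have := (h.self_iff _).1 hb
    rw [h.lower.pairing.eq_comm.1 hq] at this
    simp at this

/-- An agent whose partners in the two halves differ has its top choice in one of them. -/
theorem exists_top (h : G.IsHalves p q σ τ) {a : A} (hne : p (.inl a) ≠ q (.inl a)) :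
    ∃ b b', p (.inl a) = .inr b ∧ q (.inl a) = .inr b' ∧ b ≠ b' ∧
      ((G.IsTopJob b ∧ ¬ G.IsTopJob b') ∨ (¬ G.IsTopJob b ∧ G.IsTopJob b')) := by
  have hp : p (.inl a) ≠ .inl a := fun hp => hne (by rw [hp, (h.self_iff _).1 hp])
  obtain ⟨b, hb⟩ := Pairing.exists_inr h.upper.pairing hp
  obtain ⟨b', hb'⟩ := Pairing.exists_inr h.lower.pairing fun hq => hp ((h.self_iff _).2 hq)
  have hbb : b ≠ b' := fun he => hne (by rw [hb, hb', he])
  have hv : G.Valid (.inl a) (.inr b) := hb ▸ h.upper.valid (.inl a)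
  have hv' : G.Valid (.inl a) (.inr b') := hb' ▸ h.lower.valid (.inl a)
  refine ⟨b, b', hb, hb', hbb, ?_⟩
  by_cases ht : G.IsTopJob b <;> by_cases ht' : G.IsTopJob b'
  · exact absurd ((hv'.isF ht').unique (hv.isF ht)) hbb
  · exact Or.inl ⟨ht, ht'⟩
  · exact Or.inr ⟨ht, ht'⟩
  · exact absurd ((hv'.isS ht').unique (hv.isS ht)) hbb

end IsHalves

/-! ### Complementary slackness between the two halves -/

section Compare

variable [Fintype A] [Fintype B] {p q : A ⊕ B → A ⊕ B} {σ τ : A ⊕ B → ℤ}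

-- Setting `σ` to 0 at unmatched vertices makes its total vanish and keeps the covering inequality
-- along `q`, because `q` leaves the same vertices unmatched. So `q` cannot beat `p`, and a tie
-- forces tightness.
open Classical in
theorem IsHalf.compare (h : G.IsHalf p σ) (hq : G.Pairing q) (hpq : ∀ u, p u = u ↔ q u = u) :
    ∑ u, G.vote u (q u) (p u) ≤ 0 ∧ (∑ u, G.vote u (q u) (p u) = 0 → ∀ u, q u ≠ u →
      G.vote u (q u) (p u) + G.vote (q u) u (p (q u)) = σ u + σ (q u)) := by
  let σ' : A ⊕ B → ℤ := fun u => if p u = u then 0 else σ u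
  have hle : ∀ u, G.vote u (q u) (p u) + G.vote (q u) u (p (q u)) ≤ σ' u + σ' (q u) := by
    intro u
    by_cases hu : q u = u
    · have hu' := (hpq u).2 hu
      simp [σ', hu, hu', vote_self]
    · have h1 : p u ≠ u := fun h => hu ((hpq u).1 h)
      have h2 : p (q u) ≠ q u := fun h => hu (by
        have := (hpq _).1 h
        rw [hq.invol] at this
        exact this.symm)
      simp only [σ', h1, h2, if_false]
      exact h.cover' ((hq.opt u).vadj hu)
  have hσ' : ∑ u, σ' u = 0 := by
    have h1 := h.pairing.two_mul_sum σ'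
    have h2 : ∀ u, σ' u + σ' (p u) = 0 := fun u => by
      by_cases hu : p u = u
      · simp [σ', hu]
      · have hu' : u ≠ p u := Ne.symm hu
        simp only [σ', hu, h.pairing.invol, hu', if_false]
        exact h.add_partner u hu
    rw [Finset.sum_eq_zero fun u _ => h2 u] at h1
    omega
  have h1 := hq.two_mul_sum_vote p
  have h2 := hq.two_mul_sum σ'
  have h3 := Finset.sum_le_sum fun u (_ : u ∈ Finset.univ) => hle u
  refine ⟨by omega, fun h0 u hu => ?_⟩
  have h4 := (Finset.sum_eq_sum_iff_of_le fun u (_ : u ∈ Finset.univ) => hle u).1 (by omega) u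
    (Finset.mem_univ u)
  have h5 : p u ≠ u := fun h => hu ((hpq u).1 h)
  have h6 : p (q u) ≠ q u := fun h => hu (by
    have := (hpq _).1 h
    rw [hq.invol] at this
    exact this.symm)
  simpa only [σ', h5, h6, if_false] using h4

namespace IsHalves

/-- Neither half beats the other, so they tie and all covering inequalities between them are tight.
-/
theorem sum_vote_eq_zero (h : G.IsHalves p q σ τ) : ∑ u, G.vote u (q u) (p u) = 0 := by
  have h1 := (h.upper.compare h.lower.pairing h.self_iff).1
  have h2 := (h.lower.compare h.upper.pairing fun u => (h.self_iff u).symm).1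
  simp only [vote_swap _ (q _), Finset.sum_neg_distrib] at h2
  omega

theorem tight_upper (h : G.IsHalves p q σ τ) {u : A ⊕ B} (hu : q u ≠ u) :
    G.vote u (q u) (p u) + G.vote (q u) u (p (q u)) = σ u + σ (q u) :=
  (h.upper.compare h.lower.pairing h.self_iff).2 h.sum_vote_eq_zero u hu

theorem tight_lower (h : G.IsHalves p q σ τ) {u : A ⊕ B} (hu : p u ≠ u) :
    G.vote u (p u) (q u) + G.vote (p u) u (q (p u)) = τ u + τ (p u) := by
  refine (h.lower.compare h.upper.pairing fun u => (h.self_iff u).symm).2 ?_ u hu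
  simp only [vote_swap _ (q _), Finset.sum_neg_distrib, h.sum_vote_eq_zero, neg_zero]

/-- The signs around a top job whose partners in the two halves differ. -/
theorem sign_at_top (h : G.IsHalves p q σ τ) {b : B} {a a' : A} (hb : G.IsTopJob b)
    (hp : p (.inl a) = .inr b) (hq : q (.inl a') = .inr b) (hne : a ≠ a') :
    (σ (.inl a) = σ (.inl a') ∧ τ (.inl a) = 1 ∧ τ (.inl a') = -1) ∨
      (σ (.inl a') = 1 ∧ σ (.inl a) = -1 ∧ τ (.inl a) = τ (.inl a')) := by
  have hP := h.upper.pairing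
  have hQ := h.lower.pairing
  have hF : G.IsF a b := Valid.isF (hp ▸ h.upper.valid (.inl a)) hb
  have hF' : G.IsF a' b := Valid.isF (hq ▸ h.lower.valid (.inl a')) hb
  have t1 := h.tight_upper (u := .inl a') (by simp [hq])
  have t2 := h.tight_lower (u := .inl a) (by simp [hp])
  have s1 := h.upper.add_partner (.inl a) (by simp [hp])
  have s2 := h.lower.add_partner (.inl a') (by simp [hq])
  rw [hq, hP.eq_comm.1 hp, vote_isF hF' (hP.opt _) fun he => hne
    (Sum.inl_injective (hP.injective (hp.trans he.symm)))] at t1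
  rw [hp, hQ.eq_comm.1 hq, vote_isF hF (hQ.opt _) fun he => hne
    (Sum.inl_injective (hQ.injective (he.trans hq.symm)))] at t2
  rw [hp] at s1
  rw [hq] at s2
  -- Both agents vote 1 for `b`, so tightness gives `σ a' - σ a` and `τ a - τ a'` as 1 plus opposite
  -- votes of `b`: one difference is 0, the other 2.
  have v1 := vote_of_ne (G := G) (u := .inr b) (v := .inl a) (w := .inl a') (Or.inr hF.1)
    (Or.inr hF'.1) (by simpa using hne)
  rw [vote_swap] at t1
  have := h.upper.sign (.inl a)
  have := h.upper.sign (.inl a')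
  have := h.lower.sign (.inl a)
  have := h.lower.sign (.inl a')
  omega

/-- The signs around a job that is nobody's top choice and whose partners in the two halves
differ. -/
theorem sign_at_nontop (h : G.IsHalves p q σ τ) {b : B} {a a' : A} (hb : ¬ G.IsTopJob b)
    (hp : p (.inl a) = .inr b) (hq : q (.inl a') = .inr b) (hne : a ≠ a') :
    (σ (.inl a) = σ (.inl a') ∧ τ (.inl a) = -1 ∧ τ (.inl a') = 1) ∨
      (σ (.inl a') = -1 ∧ σ (.inl a) = 1 ∧ τ (.inl a) = τ (.inl a')) := by
  have hP := h.upper.pairing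
  have hQ := h.lower.pairing
  have hS : G.IsS a b := Valid.isS (hp ▸ h.upper.valid (.inl a)) hb
  have hS' : G.IsS a' b := Valid.isS (hq ▸ h.lower.valid (.inl a')) hb
  have t1 := h.tight_upper (u := .inl a') (by simp [hq])
  have t2 := h.tight_lower (u := .inl a) (by simp [hp])
  have s1 := h.upper.add_partner (.inl a) (by simp [hp])
  have s2 := h.lower.add_partner (.inl a') (by simp [hq])
  rw [hq, hP.eq_comm.1 hp, vote_isS hS' (h.upper.valid _) (hP.opt _) fun he => hne
    (Sum.inl_injective (hP.injective (hp.trans he.symm)))] at t1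
  rw [hp, hQ.eq_comm.1 hq, vote_isS hS (h.lower.valid _) (hQ.opt _) fun he => hne
    (Sum.inl_injective (hQ.injective (he.trans hq.symm)))] at t2
  rw [hp] at s1
  rw [hq] at s2
  have v1 := vote_of_ne (G := G) (u := .inr b) (v := .inl a) (w := .inl a') (Or.inr hS.1)
    (Or.inr hS'.1) (by simpa using hne)
  rw [vote_swap] at t1
  have := h.upper.sign (.inl a)
  have := h.upper.sign (.inl a')
  have := h.lower.sign (.inl a)
  have := h.lower.sign (.inl a')
  omega

variable {Z : Set (A ⊕ B)}

/-- The two halves agree at marked agents. -/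
theorem eq_of_marked (h : G.IsHalves p q σ τ) (hpZ : ∀ u, u ∈ Z ↔ p u ∈ Z)
    (hqZ : ∀ u, u ∈ Z ↔ q u ∈ Z) (hZ : ∀ a, .inl a ∈ Z → σ (.inl a) = -1 ∧ τ (.inl a) = 1)
    {a : A} (ha : .inl a ∈ Z) : p (.inl a) = q (.inl a) := by
  by_contra hne
  obtain ⟨b, b', hb, hb', hbb, ⟨ht, -⟩ | ⟨-, ht⟩⟩ := h.exists_top hne
  · obtain ⟨a', ha'⟩ := h.exists_lower hb
    have haa : a ≠ a' := fun he => hbb (Sum.inr_injective (by rw [← hb', ← ha', he]))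
    have hz : .inl a' ∈ Z := by rw [hqZ, ha', ← hb, ← hpZ]; exact ha
    -- `a` and `a'` are both marked and so carry equal signs, but `sign_at_top` makes their `σ` or
    -- their `τ` differ.
    have h1 := h.sign_at_top ht hb ha' haa
    have h2 := hZ a ha
    have h3 := hZ a' hz
    omega
  · obtain ⟨a', ha'⟩ := h.exists_upper hb'
    have haa : a' ≠ a := fun he => hbb (Sum.inr_injective (by rw [← hb, ← ha', he]))
    have hz : .inl a' ∈ Z := by rw [hpZ, ha', ← hb', ← hqZ]; exact ha
    have h1 := h.sign_at_top ht ha' hb' haa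
    have h2 := hZ a ha
    have h3 := hZ a' hz
    omega

/-- The signs of an unmarked agent that gets its top choice in the lower half only. -/
theorem sign_of_unmarked (h : G.IsHalves p q σ τ) (hpZ : ∀ u, u ∈ Z ↔ p u ∈ Z)
    (hqZ : ∀ u, u ∈ Z ↔ q u ∈ Z)
    (hZ' : ∀ a, .inl a ∉ Z → p (.inl a) ≠ .inl a → ¬ (σ (.inl a) = -1 ∧ τ (.inl a) = 1))
    {a : A} (ha : .inl a ∉ Z) {b b' : B} (hb : p (.inl a) = .inr b) (hb' : q (.inl a) = .inr b')
    (hbb : b ≠ b') (ht : ¬ G.IsTopJob b) (ht' : G.IsTopJob b') :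
    σ (.inl a) = 1 ∧ τ (.inl a) = -1 := by
  obtain ⟨a₁, h₁⟩ := h.exists_upper hb'
  obtain ⟨a₃, h₃⟩ := h.exists_lower hb
  have hz₁ : .inl a₁ ∉ Z := by rw [hpZ, h₁, ← hb', ← hqZ]; exact ha
  have hz₃ : .inl a₃ ∉ Z := by rw [hqZ, h₃, ← hb, ← hpZ]; exact ha
  -- Whichever alternative holds at the top job `b'`, the excluded pair (-1, 1) at its upper partner
  -- `a₁` determines the signs of `a`.
  have n₁ := h.sign_at_top ht' h₁ hb'
    fun he => hbb (Sum.inr_injective (by rw [← hb, ← h₁, he]))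
  have n₃ := h.sign_at_nontop ht hb h₃
    fun he => hbb (Sum.inr_injective (by rw [← hb', ← h₃, he]))
  have c := hZ' a ha (by simp [hb])
  have c₁ := hZ' a₁ hz₁ (by simp [h₁])
  have c₃ := hZ' a₃ hz₃ fun he => by
    rw [(h.self_iff _).1 he] at h₃
    simp at h₃
  have := h.upper.sign (.inl a)
  have := h.lower.sign (.inl a)
  omega

open Classical in
/-- If the agents in a set `Z` closed under taking partners have sign `-` in the upper and `+` in the
lower half, and no other matched agent has, then the upper half is popular. -/
theorem isWitness (h : G.IsHalves p q σ τ) (hpZ : ∀ u, u ∈ Z ↔ p u ∈ Z)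
    (hqZ : ∀ u, u ∈ Z ↔ q u ∈ Z) (hZ : ∀ a, .inl a ∈ Z → σ (.inl a) = -1 ∧ τ (.inl a) = 1)
    (hZ' : ∀ a, .inl a ∉ Z → p (.inl a) ≠ .inl a → ¬ (σ (.inl a) = -1 ∧ τ (.inl a) = 1)) :
    G.IsWitness p fun u => if u ∈ Z ∨ p u = u then 0 else σ u := by
  have hP := h.upper.pairing
  have hQ := h.lower.pairing
  have signA : ∀ a, (.inl a ∈ Z ∨ p (.inl a) = .inl a) → σ (.inl a) = -1 ∧ τ (.inl a) = 1 :=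
    fun a ha => ha.elim (hZ a) (h.self_inl a)
  have eqB : ∀ b, (.inr b ∈ Z ∨ p (.inr b) = .inr b) → p (.inr b) = q (.inr b) := by
    intro b hb
    by_cases hs : p (.inr b) = .inr b
    · rw [hs, (h.self_iff _).1 hs]
    · obtain ⟨a, ha⟩ := Pairing.exists_inl hP hs
      have haZ : .inl a ∈ Z := by rw [hpZ, ha]; exact hb.resolve_right hs
      have := h.eq_of_marked hpZ hqZ hZ haZ
      rw [hP.eq_comm.1 ha, hQ.eq_comm.1 (this.symm.trans ha)]
  have signB : ∀ b, (.inr b ∈ Z ∨ p (.inr b) = .inr b) → σ (.inr b) = 1 ∧ τ (.inr b) = -1 := by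
    intro b hb
    by_cases hs : p (.inr b) = .inr b
    · exact h.self_inr b hs
    · obtain ⟨a, ha⟩ := Pairing.exists_inl hP hs
      have haZ : .inl a ∈ Z := by rw [hpZ, ha]; exact hb.resolve_right hs
      have he := h.eq_of_marked hpZ hqZ hZ haZ
      have h1 := h.upper.add_partner (.inl a) (by simp [ha])
      have h2 := h.lower.add_partner (.inl a) (by rw [← he]; simp [ha])
      rw [ha] at h1
      rw [← he, ha] at h2
      have := hZ a haZ
      omega
  have main : ∀ a b, G.Adj a b →
      G.vote (.inl a) (.inr b) (p (.inl a)) + G.vote (.inr b) (.inl a) (p (.inr b)) ≤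
        (if .inl a ∈ Z ∨ p (.inl a) = .inl a then 0 else σ (.inl a)) +
          (if .inr b ∈ Z ∨ p (.inr b) = .inr b then 0 else σ (.inr b)) := by
    intro a b hab
    have c1 := h.upper.cover a b hab
    by_cases hb : .inr b ∈ Z ∨ p (.inr b) = .inr b
    · have sb := signB b hb
      by_cases ha : .inl a ∈ Z ∨ p (.inl a) = .inl a
      · have sa := signA a ha
        rw [if_pos ha, if_pos hb]
        omega
      -- The only delicate case: `σ b = 1` is lowered to 0. The lower half compensates, since `b`
      -- has the same partner there and `τ b = -1`; if the partners of `a` differ, validity or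
      -- `sign_of_unmarked` supplies what is missing.
      · rw [if_neg ha, if_pos hb]
        have c2 := h.lower.cover a b hab
        rw [← eqB b hb] at c2
        push Not at ha
        have na := hZ' a ha.1 ha.2
        have s1 := h.upper.sign (.inl a)
        have s2 := h.lower.sign (.inl a)
        by_cases he : p (.inl a) = q (.inl a)
        · rw [← he] at c2
          omega
        · obtain ⟨b₁, b₂, h₁, h₂, hbb, ⟨ht, -⟩ | ⟨ht, ht₂⟩⟩ := h.exists_top he
          · have hF : G.IsF a b₁ := Valid.isF (h₁ ▸ h.upper.valid (.inl a)) ht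
            have hne : b ≠ b₁ := by
              rintro rfl
              have := eqB b hb
              rw [hP.eq_comm.1 h₁, eq_comm, hQ.eq_comm, h₂] at this
              exact hbb (Sum.inr_injective this.symm)
            have v := vote_isF hF (u := .inr b) (Or.inr hab) (by simpa using hne)
            rw [h₁] at c1 ⊢
            rw [vote_swap, v] at c1 ⊢
            have := vote_le_one (G := G) (.inr b) (.inl a) (p (.inr b))
            have := neg_one_le_vote (G := G) (.inl a) (.inr b) (q (.inl a))
            omega
          · have := h.sign_of_unmarked hpZ hqZ hZ' ha.1 h₁ h₂ hbb ht ht₂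
            have := vote_le_one (G := G) (.inl a) (.inr b) (p (.inl a))
            have := neg_one_le_vote (G := G) (.inl a) (.inr b) (q (.inl a))
            omega
    · by_cases ha : .inl a ∈ Z ∨ p (.inl a) = .inl a
      · have sa := signA a ha
        rw [if_pos ha, if_neg hb]
        -- Here `σ a = -1` is raised to 0, which only weakens the inequality.
        omega
      · rw [if_neg ha, if_neg hb]
        exact c1
  constructor
  · rintro u v (rfl | huv)
    · by_cases hu : p v = v
      · simp [hu, vote_self]
      · have v1 : G.vote v v (p v) = -1 := by
          rw [vote_swap, vote_self_right ((hP.opt v).vadj hu)]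
        have := h.upper.sign v
        rw [v1]
        split_ifs <;> omega
    · rcases u with a | b <;> rcases v with a' | b'
      · exact huv.elim
      · exact main _ _ huv
      · rw [add_comm, add_comm (ite _ _ _)]; exact main _ _ huv
      · exact huv.elim
  · have h1 := hP.two_mul_sum fun u => if u ∈ Z ∨ p u = u then 0 else σ u
    have h2 : ∀ u, (if u ∈ Z ∨ p u = u then 0 else σ u) +
        (if p u ∈ Z ∨ p (p u) = p u then 0 else σ (p u)) = 0 := by
      intro u
      by_cases hu : u ∈ Z ∨ p u = u
      · have hu' : p u ∈ Z ∨ p (p u) = p u := hu.imp (hpZ u).1 fun h => by rw [h, h]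
        rw [if_pos hu, if_pos hu', add_zero]
      · have hu' : ¬ (p u ∈ Z ∨ p (p u) = p u) := by
          rw [hP.invol, eq_comm, ← hpZ]; exact hu
        rw [if_neg hu, if_neg hu']
        push Not at hu
        exact h.upper.add_partner u hu.2
    rw [Finset.sum_eq_zero fun u _ => h2 u] at h1
    omega

end IsHalves

end Compare

/-! ### The final matching of a successful execution -/

/-- Stability read as a covering inequality. With equal superscripts two favourable votes would let
a parallel copy of the edge block. If `u` has a minus edge and `v` receives a plus edge, one
favourable vote suffices, so both votes are -1. -/
theorem HStable.vote_le {S : Set (HEdge A B)} (hS : G.HStable S) {π : Equiv.Perm (A ⊕ B)}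
    {s : A ⊕ B → Bool} (hπ : ∀ e, e ∈ S ↔ e = ⟨e.left, π e.left, s e.left⟩) {u v : A ⊕ B}
    (huv : G.VAdj u v) :
    G.vote u v (π u) + G.vote v u (π.symm v) ≤
      (if s u then 1 else -1) - (if s (π.symm v) then 1 else -1) := by
  have hopt : ∀ u, G.Opt u (π u) := fun u =>
    opt_of_mem_hedges (hS.1.1 ((hπ ⟨u, π u, s u⟩).2 rfl))
  by_cases hv : π u = v
  · have hu : π.symm v = u := by rw [← hv, Equiv.symm_apply_apply]
    rw [hu, hv, vote_self, vote_self]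
    simp
  have hu : π.symm v ≠ u := fun hu => hv (by rw [← hu, Equiv.apply_symm_apply])
  have v1 := vote_of_ne (Or.inr huv) (hopt u) (Ne.symm hv)
  have v2 := vote_of_ne (G := G) (u := v) (w := π.symm v) (Or.inr huv.symm)
    (by simpa using (hopt (π.symm v)).symm) hu.symm
  have nb : ∀ c : Bool,
      ¬ (((c = true ∧ s u = false) ∨ (c = s u ∧ G.vote u v (π u) = 1)) ∧
        ((c = false ∧ s (π.symm v) = true) ∨
          (c = s (π.symm v) ∧ G.vote v u (π.symm v) = 1))) := by
    rintro c ⟨h1, h2⟩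
    rw [vote_eq_one_iff] at h1 h2
    refine hS.2 ⟨u, v, c⟩ ⟨Or.inl huv, fun e he hl => ?_, fun e he hr => ?_⟩
    · rw [(hπ e).1 he, show e.left = u from hl]
      exact (leftKey_lt_iff G).2 h1
    · rw [hπ] at he
      have hl : e.left = π.symm v := by
        rw [Equiv.eq_symm_apply, ← show e.right = v from hr, he]
      rw [he, hl, Equiv.apply_symm_apply]
      exact (rightKey_lt_iff G).2 h2
  have n1 := nb true
  have n2 := nb false
  cases h1 : s u <;> cases h2 : s (π.symm v) <;> rcases v1 with v1 | v1 <;>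
    rcases v2 with v2 | v2 <;> simp_all

/-- The two halves of the final matching, together with the marked vertices. -/
theorem Reaches.exists_isHalves [Fintype A] [Fintype B] {F R : Set (HEdge A B)} {Z : Set (A ⊕ B)}
    (h : G.Reaches F R Z) (hcrit : critical (G.held R) ⊆ Z) :
    ∃ p q σ τ, G.IsHalves p q σ τ ∧ upper (G.held R) = ofPartner p ∧
      UA (G.held R) = {a | p (.inl a) = .inl a} ∧
      (∀ u, u ∈ Z ↔ p u ∈ Z) ∧ (∀ u, u ∈ Z ↔ q u ∈ Z) ∧
      (∀ a, .inl a ∈ Z → σ (.inl a) = -1 ∧ τ (.inl a) = 1) ∧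
      ∀ a, .inl a ∉ Z → p (.inl a) ≠ .inl a → ¬ (σ (.inl a) = -1 ∧ τ (.inl a) = 1) := by
  obtain ⟨π, s, hπ⟩ := h.final.exists_perm
  have edge : ∀ u, ⟨u, π u, s u⟩ ∈ G.held R := fun u => (hπ _).2 rfl
  have edge' : ∀ u, ⟨π.symm u, u, s (π.symm u)⟩ ∈ G.held R := fun u => (hπ _).2 (by simp)
  have hopt : ∀ u, G.Opt u (π u) := fun u => opt_of_mem_hedges (edge u).1
  have hopt' : ∀ u, G.Opt u (π.symm u) := fun u => (opt_of_mem_hedges (edge' u).1).symm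
  have hlegal : ∀ e ∈ G.held R, G.Legal e.left e.right := fun e he => by
    by_contra hl
    exact Set.disjoint_left.1 h.final.held_disjoint he (h.illegal_subset ⟨he.1, hl⟩)
  have hfix : ∀ u, π u = u → s u = false := fun u hu => by
    rcases (edge u).1 with h | h
    · exact absurd hu.symm h.ne
    · exact h.2
  have hfix_iff : ∀ u, π u = u ↔ π.symm u = u := fun u => by
    rw [Equiv.symm_apply_eq, eq_comm]
  let L : A ⊕ B → ℤ := fun u => if s u then 1 else -1
  have hL : ∀ u, L u = 1 ∨ L u = -1 := fun u => by simp only [L]; split_ifs <;> simp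
  have hLf : ∀ u, L u = -1 ↔ s u = false := fun u => by simp only [L]; cases s u <;> simp
  have stab : ∀ u v, G.VAdj u v →
      G.vote u v (π u) + G.vote v u (π.symm v) ≤ L u - L (π.symm v) :=
    fun u v huv => h.final.hStable.vote_le hπ huv
  -- The upper half reads agents on the left and jobs on the right, the lower half the reverse.
  -- Signs are those of `L`, negated when a vertex is read on the right, so that they cancel along
  -- matched edges.
  refine ⟨Sum.elim (fun a => π (.inl a)) fun b => π.symm (.inr b),
    Sum.elim (fun a => π.symm (.inl a)) fun b => π (.inr b),
    Sum.elim (fun a => L (.inl a)) fun b => - L (π.symm (.inr b)),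
    Sum.elim (fun a => - L (π.symm (.inl a))) fun b => L (.inr b),
    ⟨⟨pairing_of_perm π hopt, ?_, ?_, ?_, ?_⟩, ⟨pairing_of_perm π.symm hopt', ?_, ?_, ?_, ?_⟩,
      ?_, ?_, ?_⟩, ?_, ?_, ?_, ?_, ?_, ?_⟩
  · intro a b hab
    exact stab (.inl a) (.inr b) hab
  · have hp := pairing_of_perm π hopt
    rintro (a | b) hu
    · obtain ⟨b, hb⟩ := hp.exists_inr hu
      rw [hb]
      simp only [Sum.elim_inl, Sum.elim_inr] at hb ⊢
      rw [← hb, Equiv.symm_apply_apply, add_neg_cancel]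
    · obtain ⟨a, ha⟩ := hp.exists_inl hu
      rw [hp.eq_comm.1 ha]
      simp only [Sum.elim_inl, Sum.elim_inr] at ha ⊢
      rw [← ha, Equiv.symm_apply_apply, neg_add_cancel]
  · rintro (a | b)
    · exact hL _
    · have := hL (π.symm (.inr b))
      simp only [Sum.elim_inr]
      omega
  · rintro (a | b)
    · exact (hlegal _ (edge _)).1
    · exact (hlegal _ (edge' _)).1.symm
  · intro a b hab
    have := stab (.inr b) (.inl a) hab
    simp only [Sum.elim_inl, Sum.elim_inr]
    linarith
  · have hp := pairing_of_perm π.symm hopt'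
    rintro (a | b) hu
    · obtain ⟨b, hb⟩ := hp.exists_inr hu
      simp only [Sum.elim_inl] at hb ⊢
      rw [hb, Sum.elim_inr, neg_add_cancel]
    · obtain ⟨a, ha⟩ := hp.exists_inl hu
      have ha' := hp.eq_comm.1 ha
      simp only [Sum.elim_inl, Sum.elim_inr, Equiv.symm_symm] at ha ha' ⊢
      rw [ha', Sum.elim_inl, ha, add_neg_cancel]
  · rintro (a | b)
    · have := hL (π.symm (.inl a))
      simp only [Sum.elim_inl]
      omega
    · exact hL _
  · rintro (a | b)
    · exact (hlegal _ (edge' _)).1.symm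
    · exact (hlegal _ (edge _)).1
  · rintro (a | b)
    · exact hfix_iff _
    · exact (hfix_iff _).symm
  · intro a ha
    simp only [Sum.elim_inl] at ha ⊢
    rw [(hfix_iff _).1 ha, (hLf _).2 (hfix _ ha)]
    simp
  · intro b hb
    simp only [Sum.elim_inr] at hb ⊢
    rw [hb, (hLf _).2 (hfix _ ((hfix_iff _).2 hb))]
    simp
  · ext ⟨a, b⟩
    constructor
    · rintro ⟨c, hc⟩
      exact (congrArg HEdge.right ((hπ _).1 hc)).symm
    · intro hab
      have := edge (.inl a)
      rw [show π (.inl a) = .inr b from hab] at this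
      exact ⟨_, this⟩
  · ext a
    constructor
    · intro ha
      exact (congrArg HEdge.right ((hπ _).1 ha)).symm
    · intro ha
      have := edge (.inl a)
      rw [hfix _ ha, show π (.inl a) = .inl a from ha] at this
      exact this
  · rintro (a | b)
    · exact h.marked_iff (hlegal _ (edge _)).2
    · exact (h.marked_iff (hlegal _ (edge' _)).2).symm
  · rintro (a | b)
    · exact (h.marked_iff (hlegal _ (edge' _)).2).symm
    · exact h.marked_iff (hlegal _ (edge _)).2
  · intro a ha
    -- All plus edges at both copies of a marked agent are forbidden, which fixes its two signs.
    have key : ∀ e ∈ G.held R, e.left = .inl a ∨ e.right = .inl a → e.plus = false :=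
      fun e he hea => Bool.eq_false_of_not_eq_true fun hplus =>
        Set.disjoint_left.1 h.final.held_disjoint he (h.forbidden_of_marked ha he.1 hplus hea)
    have h1 := (hLf _).2 (key _ (edge (.inl a)) (Or.inl rfl))
    have h2 := (hLf _).2 (key _ (edge' (.inl a)) (Or.inr rfl))
    simp only [Sum.elim_inl]
    omega
  · rintro a ha hne ⟨h1, h2⟩
    -- A matched agent with these signs lies in `AMinus ∩ APlus'`, so the loop could not have
    -- stopped with it unmarked.
    refine ha (hcrit (Or.inl ⟨a, ⟨?_, ?_⟩, rfl⟩))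
    · obtain ⟨b, hb⟩ := (pairing_of_perm π hopt).exists_inr hne
      have := edge (.inl a)
      rw [(hLf _).1 h1, show π (.inl a) = .inr b from hb] at this
      exact ⟨b, this⟩
    · have hne' : π.symm (.inl a) ≠ .inl a := fun he => hne ((hfix_iff _).2 he)
      obtain ⟨b, hb⟩ := (pairing_of_perm π.symm hopt').exists_inr hne'
      have := edge' (.inl a)
      simp only [Sum.elim_inl] at h2
      rw [(hLf _).1 (by omega), show π.symm (.inl a) = .inr b from hb] at this
      exact ⟨b, this⟩

theorem IsMatching.ncard_eq {M : Set (A × B)} (hM : G.IsMatching M) :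
    M.ncard = {a | ∃ b, (a, b) ∈ M}.ncard := by
  have hinj : Set.InjOn Prod.fst M := fun x hx y hy hxy =>
    Prod.ext hxy (hM.2.1 y.1 x.2 y.2 (by rw [← hxy]; exact hx) hy)
  rw [← hinj.ncard_image]
  congr 1
  ext a
  simp

end Marriage

/-! ### The main theorem -/

theorem mainTheorem7 {A B : Type*} [Finite A] [Finite B] (G : Marriage A B)
    (hA : ∀ a, ∃ b, G.Adj a b)
    (F S : Set (Marriage.HEdge A B)) (M : Set (A × B)) (hret : G.Returns F S M) :
    G.MaxSizeFullyPopular M ∧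
    G.IsLeftOptimal (G.stableAvoiding F) S ∧
    {a | ∀ b, (a, b) ∉ M} = Marriage.UA S ∧
    ∀ N, G.FullyPopular N → ∀ a ∈ Marriage.UA S, ∀ b, (a, b) ∉ N := by
  have := Fintype.ofFinite A
  have := Fintype.ofFinite B
  obtain ⟨R, Z, hr, hcrit, rfl, rfl⟩ := hret
  obtain ⟨p, q, σ, τ, hh, hM, hU, hpZ, hqZ, hZ, hZ'⟩ := hr.exists_isHalves hcrit
  have hp := hh.upper.pairing
  have hUA : {a | ∀ b, (a, b) ∉ Marriage.upper (G.held R)} = Marriage.UA (G.held R) := by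
    rw [hM, hU]
    ext a
    rw [Set.mem_ofPred_eq, Set.mem_ofPred_eq, ← hp.partner_ofPartner,
      Marriage.partner_inl_self_iff, hp.partner_ofPartner]
    simp
  have hun : ∀ N, G.FullyPopular N → ∀ a ∈ Marriage.UA (G.held R), ∀ b, (a, b) ∉ N :=
    fun N hN a ha b => hN.not_mem_of_mem_UA hr ha b
  have hfull : G.FullyPopular (Marriage.upper (G.held R)) := by
    rw [hM]
    refine ⟨(hh.isWitness hpZ hqZ hZ hZ').popular hp,
      Marriage.aPopular_of_valid hp.isMatching fun u => ?_⟩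
    rw [hp.partner_ofPartner]
    exact hh.upper.valid u
  refine ⟨⟨hfull, fun N hN => ?_⟩, hr.final.isLeftOptimal, hUA, hun⟩
  rw [hN.1.1.ncard_eq, hfull.1.1.ncard_eq]
  -- The matched agents of `N` are among those of the output, as every agent unmatched in the output
  -- lies in `UA`.
  refine Set.ncard_le_ncard ?_
  rintro a ⟨b, hb⟩
  by_contra hna
  refine hun N hN a ?_ b hb
  rw [← hUA]
  exact fun b' hb' => hna ⟨b', hb'⟩
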